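/- Let $\ell\ge 1$ and $n\ge 2$, and let $X=(x_{ij})$ be an $\ell\times n$ matrix of independent variables. The symmetric group $\mathfrak S_n$ acts on $\mathbb R[X]$ by $\sigma\cdot x_{ij}=x_{i\sigma(j)}$. Write $\partial_{ij}=\partial/\partial x_{ij}$ and, for $1\le i,k\le \ell$ and $p\ge 1$, $E_{i,k}^{(p)}=\sum_{j=1}^n x_{ij}\,\partial_{kj}^{\,p}$. For $f\in\mathbb R[X]$ let $\mathcal M_f$ be the smallest real subspace of $\mathbb R[X]$ that contains $\sigma\cdot f$ for all $\sigma\in\mathfrak S_n$ and is closed under all $\partial_{ij}$ and all $E_{i,k}^{(p)}$. For $\mathbf d\in\mathbb N^\ell$ let $(\mathcal M_f)_{\mathbf d}$ be the subspace of those elements of $\mathcal M_f$ that are homogeneous of degree $d_i$ in $x_{i1},\dots,x_{in}$ for every $i$. The graded Frobenius characteristic of $\mathcal M_f$ is $$\mathcal M_f(\mathbf q,\mathbf w)=\sum_{\mathbf d\in\mathbb N^\ell}\Big(\frac1{n!}\sum_{\sigma\in\mathfrak S_n}\chi_{(\mathcal M_f)_{\mathbf d}}(\sigma)\,p_{\lambda(\sigma)}(\mathbf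 w)\Big)\mathbf q^{\mathbf d},$$ where $\mathbf q=(q_1,\dots,q_\ell)$, $\mathbf w=(w_1,w_2,\dots)$, $\chi$ denotes the $\mathfrak S_n$-character and $\lambda(\sigma)$ is the cycle type of $\sigma$. Let $h_\mu$, $s_\mu$, $m_\mu$, $p_\mu$ denote the complete homogeneous, Schur, monomial and power sum symmetric functions. Theorem. Let $a,b,c\in\mathbb R$ and let $f=a\,m_3+b\,m_{21}+c\,m_{111}$ in the $n$ variables $x_{11},\dots,x_{1n}$, and suppose $f\neq 0$. Call $f$ an $n$-exception if the real span of $\partial_{11}f,\dots,\partial_{1n}f,E_{1,1}^{(2)}f$ has dimension $n$. 1. If $f$ is a scalar multiple of $m_3+3m_{21}+6m_{111}=p_1^3$ (for $n\ge 3$ this means $[a:b:c]=[1:3:6]$; for $n=2$, where $m_{111}=0$, it means $b=3a$), then $$\mathcal M_f(\mathbf q,\mathbf w)=\big(1+h_1(\mathbf q)+h_2(\mathbf q)+h_3(\mathbf q)\big)h_n(\mathbf w).$$ 2. If $f$ is an $n$-exception, then $$\mathcal M_f(\mathbf q,\mathbf w)=\big(1+h_3(\mathbf q)\big)h_n(\mathbf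 w)+\big(h_1(\mathbf q)+h_2(\mathbf q)\big)h_{n-1,1}(\mathbf w)$$ $$=\big(1+s_1(\mathbf q)+s_2(\mathbf q)+s_3(\mathbf q)\big)s_n(\mathbf w)+\big(s_1(\mathbf q)+s_2(\mathbf q)\big)s_{n-1,1}(\mathbf w).$$ 3. Otherwise, $$\mathcal M_f(\mathbf q,\mathbf w)=\big(1+h_2(\mathbf q)+h_3(\mathbf q)\big)h_n(\mathbf w)+\big(h_1(\mathbf q)+h_2(\mathbf q)\big)h_{n-1,1}(\mathbf w)$$ $$=\big(1+s_1(\mathbf q)+2s_2(\mathbf q)+s_3(\mathbf q)\big)s_n(\mathbf w)+\big(s_1(\mathbf q)+s_2(\mathbf q)\big)s_{n-1,1}(\mathbf w).$$ -/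

import Mathlib

noncomputable section

namespace Polarization

/-! ### Symmetric functions

Symmetric functions in a (finite or infinite) family of variables indexed by `ι`, as formal power
series. The variables `q_1, …, q_ℓ` are indexed by `Fin ℓ`, the variables `w_1, w_2, …` by `ℕ`. -/

/-- The complete homogeneous symmetric function `h_k`: the sum of all monomials of degree `k`. -/
def hSym (ι R : Type*) [CommRing R] (k : ℕ) : MvPowerSeries ι R :=
  fun m => if m.degree = k then 1 else 0

open Classical in
/-- The power sum `p_k = ∑ i, (x_i) ^ k`, used for `k ≥ 1`. -/
def pSym (ι R : Type*) [CommRing R] (k : ℕ) : MvPowerSeries ι R :=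
  fun m => if ∃ i, m = Finsupp.single i k then 1 else 0

/-- `h_μ = h_{μ_1} h_{μ_2} ⋯`. -/
def hSymPart (ι R : Type*) [CommRing R] (μ : List ℕ) : MvPowerSeries ι R :=
  (μ.map (hSym ι R)).prod

/-- The Schur function `s_μ = det (h_{μ_i - i + j})`, where `h_k = 0` for `k < 0`,
of a partition `μ` given as the weakly decreasing list of its parts. -/
def schur (ι R : Type*) [CommRing R] (μ : List ℕ) : MvPowerSeries ι R :=
  Matrix.det (Matrix.of fun i j : Fin μ.length =>
    if (i : ℕ) ≤ μ.get i + j then hSym ι R (μ.get i + j - i) else 0)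

/-! ### Polynomials in `ℓ` sets of `n` variables -/

/-- The polynomials in the entries `x_{ij}` of an `ℓ × n` matrix of variables. -/
abbrev MatPoly (ℓ n : ℕ) : Type := MvPolynomial (Fin ℓ × Fin n) ℝ

variable {ℓ n : ℕ}

/-- The diagonal action of the symmetric group: `σ` replaces `x_{ij}` by `x_{i σ(j)}`. -/
def diagAction (ℓ n : ℕ) : Representation ℝ (Equiv.Perm (Fin n)) (MatPoly ℓ n) where
  toFun σ := (MvPolynomial.rename (Prod.map id σ)).toLinearMap
  map_one' := by
    refine LinearMap.ext fun g => ?_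
    change MvPolynomial.rename id g = g
    exact MvPolynomial.rename_id_apply g
  map_mul' σ τ := by
    refine LinearMap.ext fun g => ?_
    simp only [AlgHom.toLinearMap_apply, Module.End.mul_apply, MvPolynomial.rename_rename]
    rfl

/-- The partial derivative `∂_{ij}`. -/
def partialD (i : Fin ℓ) (j : Fin n) : MatPoly ℓ n →ₗ[ℝ] MatPoly ℓ n :=
  (MvPolynomial.pderiv (R := ℝ) (i, j)).toLinearMap

/-- The generalized polarization operator `E_{i,k}^{(p)} = ∑ j, x_{ij} ∂_{kj}^p`. -/
def polOp (i k : Fin ℓ) (p : ℕ) : MatPoly ℓ n →ₗ[ℝ] MatPoly ℓ n :=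
  ∑ j : Fin n, LinearMap.mulLeft ℝ (MvPolynomial.X (i, j)) ∘ₗ (partialD k j ^ p)

/-- `V` is closed under derivatives and closed under polarization. -/
def IsClosedUnder (V : Submodule ℝ (MatPoly ℓ n)) : Prop :=
  (∀ i j, ∀ g ∈ V, partialD i j g ∈ V) ∧
    ∀ i k p, 1 ≤ p → ∀ g ∈ V, polOp i k p g ∈ V

/-- The smallest subspace that contains `F` and is closed under derivatives and polarization. -/
def polClosure (F : Set (MatPoly ℓ n)) : Submodule ℝ (MatPoly ℓ n) :=
  sInf {V | F ⊆ V ∧ IsClosedUnder V}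

lemma diagAction_partialD (σ : Equiv.Perm (Fin n)) (i : Fin ℓ) (j : Fin n) (g : MatPoly ℓ n) :
    diagAction ℓ n σ (partialD i j g) = partialD i (σ j) (diagAction ℓ n σ g) := by
  have hinj : Function.Injective (Prod.map (id : Fin ℓ → Fin ℓ) σ) :=
    Function.injective_id.prodMap σ.injective
  exact (MvPolynomial.pderiv_rename hinj (i, j) g).symm

lemma diagAction_partialD_pow (σ : Equiv.Perm (Fin n)) (i : Fin ℓ) (j : Fin n) (p : ℕ)
    (g : MatPoly ℓ n) :
    diagAction ℓ n σ ((partialD i j ^ p) g) = (partialD i (σ j) ^ p) (diagAction ℓ n σ g) := by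
  induction p with
  | zero => simp
  | succ p ih => simp only [pow_succ', Module.End.mul_apply, diagAction_partialD, ih]

lemma diagAction_polOp (σ : Equiv.Perm (Fin n)) (i k : Fin ℓ) (p : ℕ) (g : MatPoly ℓ n) :
    diagAction ℓ n σ (polOp i k p g) = polOp i k p (diagAction ℓ n σ g) := by
  have hmul : ∀ j (a : MatPoly ℓ n), diagAction ℓ n σ (MvPolynomial.X (i, j) * a) =
      MvPolynomial.X (i, σ j) * diagAction ℓ n σ a := by
    intro j a
    simp [diagAction]
  simp only [polOp, LinearMap.sum_apply, LinearMap.comp_apply, LinearMap.mulLeft_apply, map_sum,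
    hmul, diagAction_partialD_pow]
  exact Equiv.sum_comp σ fun j =>
    (MvPolynomial.X (i, j) : MatPoly ℓ n) * (partialD k j ^ p) (diagAction ℓ n σ g)

/-- The polarization module `M_f` generated by the orbit `{σ · f}`, with its diagonal action of the
symmetric group. -/
def polModule (f : MatPoly ℓ n) : Subrepresentation (diagAction ℓ n) where
  toSubmodule := polClosure (Set.range fun σ => diagAction ℓ n σ f)
  apply_mem_toSubmodule := by
    intro σ g hg
    simp only [polClosure, Submodule.mem_sInf, Set.mem_ofPred_eq] at hg ⊢
    intro V hV
    refine hg (V.comap (diagAction ℓ n σ)) ⟨?_, ?_, ?_⟩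
    · rintro _ ⟨τ, rfl⟩
      refine hV.1 ⟨σ * τ, ?_⟩
      simp
    · intro i j g hg
      rw [Submodule.mem_comap, diagAction_partialD]
      exact hV.2.1 _ _ _ hg
    · intro i k p hp g hg
      rw [Submodule.mem_comap, diagAction_polOp]
      exact hV.2.2 _ _ _ hp _ hg

/-- The polynomials that are homogeneous of vector degree `d`, where `d i` is the degree in the
`i`-th set of variables `x_{i1}, …, x_{in}`. -/
def degreePart (ℓ n : ℕ) (d : Fin ℓ →₀ ℕ) : Subrepresentation (diagAction ℓ n) where
  toSubmodule := MvPolynomial.weightedHomogeneousSubmodule ℝ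
    (fun v : Fin ℓ × Fin n => Finsupp.single v.1 1) d
  apply_mem_toSubmodule := by
    intro σ g hg
    rw [MvPolynomial.mem_weightedHomogeneousSubmodule] at hg ⊢
    intro m hm
    obtain ⟨u, rfl, hu⟩ := MvPolynomial.coeff_rename_ne_zero _ _ _ hm
    rw [← hg hu, Finsupp.weight_apply, Finsupp.weight_apply,
      Finsupp.sum_mapDomain_index (by simp) (by intros; simp [add_smul])]
    rfl

/-- The graded Frobenius characteristic
`V(q, w) = ∑ d, (1 / n!) (∑ σ, χ_{V_d}(σ) p_{λ(σ)}(w)) q^d`, where `V_d` is the part of `V` of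
vector degree `d` and `λ(σ)` is the cycle type of `σ` (fixed points included). -/
def frobChar (V : Subrepresentation (diagAction ℓ n)) :
    MvPowerSeries (Fin ℓ) (MvPowerSeries ℕ ℝ) :=
  fun d => ((n.factorial : ℝ)⁻¹) • ∑ σ : Equiv.Perm (Fin n),
    (V ⊓ degreePart ℓ n d).toRepresentation.character σ •
      (σ.partition.parts.map (pSym ℕ ℝ)).prod

/-- The polynomial `a m_3 + b m_{21} + c m_{111}` in the first set of variables
`x_{11}, …, x_{1n}`. -/
def cubic (ℓ n : ℕ) [NeZero ℓ] (a b c : ℝ) : MatPoly ℓ n :=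
  MvPolynomial.rename (fun j => ((0 : Fin ℓ), j))
    (a • MvPolynomial.msymm (Fin n) ℝ (.ofSums 3 {3} rfl) +
      b • MvPolynomial.msymm (Fin n) ℝ (.ofSums 3 {2, 1} rfl) +
      c • MvPolynomial.msymm (Fin n) ℝ (.ofSums 3 {1, 1, 1} rfl))

/-- `f` is an `n`-exception: the real span of `∂_{11} f, …, ∂_{1n} f, E_{1,1}^{(2)} f` has
dimension `n`. -/
def IsException [NeZero ℓ] (f : MatPoly ℓ n) : Prop :=
  Module.finrank ℝ (Submodule.span ℝ
    (Set.range (fun j : Fin n => partialD (0 : Fin ℓ) j f) ∪ {polOp (0 : Fin ℓ) 0 2 f})) = n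

/-- `h_k(q)`, as a series in `q` with coefficients in the series in `w`. -/
abbrev hq (ℓ k : ℕ) : MvPowerSeries (Fin ℓ) (MvPowerSeries ℕ ℝ) :=
  hSym (Fin ℓ) (MvPowerSeries ℕ ℝ) k

/-- `s_k(q)`. -/
abbrev sq (ℓ k : ℕ) : MvPowerSeries (Fin ℓ) (MvPowerSeries ℕ ℝ) :=
  schur (Fin ℓ) (MvPowerSeries ℕ ℝ) [k]

/-- `h_μ(w)`, as a series in `q` that is constant in `q`. -/
abbrev hw (ℓ : ℕ) (μ : List ℕ) : MvPowerSeries (Fin ℓ) (MvPowerSeries ℕ ℝ) :=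
  MvPowerSeries.C (hSymPart ℕ ℝ μ)

/-- `s_μ(w)`, as a series in `q` that is constant in `q`. -/
abbrev sw (ℓ : ℕ) (μ : List ℕ) : MvPowerSeries (Fin ℓ) (MvPowerSeries ℕ ℝ) :=
  MvPowerSeries.C (schur ℕ ℝ μ)

end Polarization

end

/-! Write `f` as the cubic form of a symmetric tensor `T` that is invariant under simultaneous
relabelling of its three indices. On the forms `lin`, `quad` and `cub`, derivatives take slices of
the coefficients, the operators `E^{(1)}` replace a row by another, and `E^{(2)}`, `E^{(3)}`
contract along diagonals. So `M_f` is governed by `T`, by the space `W` of matrices spanned by the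
slices `T j` (from the `∂_{1j} f`) and the contraction `j ↦ T j j` (from `E_{1,1}^{(2)} f`), by a
space `V` of coefficient vectors, and by the constants. Ordinary polarization spreads each of these
over all rows, so all vector degrees of total degree `k` carry the same representation, which
therefore appears multiplied by `h_k(q)` (`IsPolarizationBasis.frobChar_eq`).

If two slices coincide, `T` is constant (`cubicTensor_eq_const`) and `f` is a multiple of `p_1^3`;
then every degree up to three carries one trivial representation. Otherwise `V` is all of `ℝ^n`,
being a permutation-invariant subspace that contains a nonconstant vector and a vector of nonzero
sum (`eq_top_of_perm_invariant`). Moreover `W`, spanned by `n + 1` matrices, contains `n`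
independent ones of the form `T i + t • contraction`, which the symmetric group permutes like `1, …,
n` (`exists_permuted_basis`). Hence `dim W` is `n`, the exceptional case, and `W` is the permutation
representation; or it is `n + 1`, and the contraction adds a trivial summand.

All representations that occur have permuted bases, so their characters count fixed labels.
Expanding power sums as counts of invariant colourings and applying Burnside's lemma turns these
characters into `h_n` and `h_{n-1,1}`; the Schur forms follow from `h_{n-1,1} = s_{n-1,1} + s_n`. -/

noncomputable section
namespace Polarization

open Equiv Finset

/-! ### Colourings fixed by a permutation, counted by Burnside's lemma -/

section Colorings

variable {α : Type*} [Fintype α]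

/-- The number of times that each colour is used by the colouring `c`. -/
def colorCount (c : α → ℕ) : ℕ →₀ ℕ := ∑ a, Finsupp.single (c a) 1

lemma colorCount_apply (c : α → ℕ) (j : ℕ) : colorCount c j = #{a | c a = j} := by
  classical
  simp only [colorCount, Finsupp.finsetSum_apply, Finsupp.single_apply, Finset.card_filter]

lemma colorCount_comp_equiv (c : α → ℕ) (σ : Perm α) : colorCount (c ∘ σ) = colorCount c :=
  Equiv.sum_comp σ fun a => Finsupp.single (c a) 1

lemma degree_colorCount (c : α → ℕ) : (colorCount c).degree = Fintype.card α := by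
  simp [colorCount, map_sum, Finsupp.degree_single]

lemma exists_perm_of_colorCount_eq {c d : α → ℕ} (h : colorCount c = colorCount d) :
    ∃ σ : Perm α, d ∘ σ = c := by
  classical
  have hcard : ∀ j, Nonempty ({a // c a = j} ≃ {a // d a = j}) := by
    intro j
    refine ⟨Fintype.equivOfCardEq ?_⟩
    rw [Fintype.card_subtype, Fintype.card_subtype, ← colorCount_apply, ← colorCount_apply, h]
  refine ⟨Equiv.ofFiberEquiv fun j => (hcard j).some, ?_⟩
  funext a
  exact Equiv.ofFiberEquiv_map _ a

/-- The colourings with prescribed numbers of uses of the colours. -/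
def Coloring (α : Type*) [Fintype α] (m : ℕ →₀ ℕ) : Type _ := {c : α → ℕ // colorCount c = m}

variable {m : ℕ →₀ ℕ}

lemma Coloring.mem_support (c : Coloring α m) (a : α) : c.1 a ∈ m.support := by
  classical
  rw [Finsupp.mem_support_iff, ← congrArg (fun f : ℕ →₀ ℕ => f (c.1 a)) c.2, colorCount_apply]
  exact (Finset.card_pos.mpr ⟨a, by simp⟩).ne'

instance : Finite (Coloring α m) := by
  refine Finite.of_injective (fun c a => (⟨c.1 a, c.mem_support a⟩ : m.support)) ?_
  intro c d h
  exact Subtype.ext (funext fun a => congrArg Subtype.val (congrFun h a))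

instance : MulAction (Perm α) (Coloring α m) where
  smul σ c := ⟨c.1 ∘ ⇑σ⁻¹, (colorCount_comp_equiv _ _).trans c.2⟩
  one_smul _ := rfl
  mul_smul _ _ _ := rfl

lemma Coloring.smul_val (σ : Perm α) (c : Coloring α m) : (σ • c).1 = c.1 ∘ ⇑σ⁻¹ := rfl

lemma Coloring.smul_eq_iff (σ : Perm α) (c d : Coloring α m) : σ • c = d ↔ d.1 ∘ σ = c.1 := by
  constructor
  · rintro rfl
    funext a
    simp [Coloring.smul_val]
  · intro h
    refine Subtype.ext (funext fun a => ?_)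
    rw [Coloring.smul_val, ← h]
    simp

lemma exists_coloring (hm : m.degree = Fintype.card α) : Nonempty (Coloring α m) := by
  classical
  let e : α ≃ Σ j : m.support, Fin (m j) := Fintype.equivOfCardEq <| by
    rw [Fintype.card_sigma, ← hm, Finsupp.degree_apply, ← Finset.sum_coe_sort m.support]
    simp
  refine ⟨⟨fun a => ((e a).1 : ℕ), ?_⟩⟩
  rw [colorCount, Equiv.sum_comp e fun x : (Σ j : m.support, Fin (m j)) =>
    Finsupp.single (x.1 : ℕ) 1, Fintype.sum_sigma]
  simp only [Finset.sum_const, Finset.card_univ, Fintype.card_fin, Finsupp.smul_single, smul_eq_mul,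
    mul_one]
  rw [Finset.sum_coe_sort m.support fun j => Finsupp.single j (m j)]
  exact Finsupp.sum_single m

lemma Coloring.exists_smul_eq (c d : Coloring α m) : ∃ σ : Perm α, σ • c = d := by
  obtain ⟨σ, hσ⟩ := exists_perm_of_colorCount_eq (c.2.trans d.2.symm)
  exact ⟨σ, (c.smul_eq_iff σ d).mpr hσ⟩

/-- A permutation carrying `c` to `d` can be corrected by a transposition inside one colour class of
`d`, so the image of one point of the right colour may be prescribed. -/
lemma Coloring.exists_smul_eq_of_apply_eq (c d : Coloring α m) (a b : α) (h : c.1 a = d.1 b) :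
    ∃ σ : Perm α, σ a = b ∧ σ • c = d := by
  classical
  obtain ⟨σ, hσ⟩ := c.exists_smul_eq d
  rw [c.smul_eq_iff] at hσ
  refine ⟨swap (σ a) b * σ, by simp, ?_⟩
  rw [c.smul_eq_iff, ← hσ]
  have hab : d.1 (σ a) = d.1 b := by rw [← h, ← hσ]; rfl
  funext x
  simp only [Function.comp_apply, Perm.coe_mul, swap_apply_def]
  split_ifs with h1 h2
  · rw [h1, hab]
  · rw [h2, hab]
  · rfl

/-- The number of colourings with given colour counts that are fixed by `σ`. -/
def fixedColorings (σ : Perm α) (m : ℕ →₀ ℕ) : ℕ :=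
  Nat.card {c : Coloring α m // c.1 ∘ σ = c.1}

lemma fixedColorings_eq [Fintype (Coloring α m)] (σ : Perm α)
    [Fintype (MulAction.fixedBy (Coloring α m) σ)] :
    fixedColorings σ m = Fintype.card (MulAction.fixedBy (Coloring α m) σ) := by
  rw [fixedColorings, ← Nat.card_eq_fintype_card]
  exact Nat.card_congr (Equiv.subtypeEquivRight fun c => (c.smul_eq_iff σ c).symm)

/-- Burnside's lemma: colourings with given colour counts form a single orbit, or there are none
when the counts do not add up to the number of points. -/
lemma sum_fixedColorings [DecidableEq α] (m : ℕ →₀ ℕ) :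
    ∑ σ : Perm α, fixedColorings σ m =
      if m.degree = Fintype.card α then (Fintype.card α).factorial else 0 := by
  classical
  have := Fintype.ofFinite (Coloring α m)
  simp only [fixedColorings_eq]
  rw [MulAction.sum_card_fixedBy_eq_card_orbits_mul_card_group, Fintype.card_perm]
  split_ifs with hm
  · obtain ⟨c⟩ := exists_coloring hm
    have : Fintype.card (Quotient (MulAction.orbitRel (Perm α) (Coloring α m))) = 1 := by
      rw [Fintype.card_eq_one_iff]
      refine ⟨Quotient.mk _ c, fun q => Quotient.inductionOn q fun d => Quotient.sound ?_⟩
      exact MulAction.orbitRel_apply.mpr (c.exists_smul_eq d)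
    rw [this, one_mul]
  · have : IsEmpty (Coloring α m) := ⟨fun c => hm (c.2 ▸ degree_colorCount c.1)⟩
    rw [Fintype.card_eq_zero, zero_mul]

/-- Burnside's lemma for colourings with a marked point: the orbit of such a pair is determined by
the colour of the mark, and every colour in the support of `m` occurs. -/
lemma sum_card_fixed_mul_fixedColorings [DecidableEq α] (m : ℕ →₀ ℕ) :
    ∑ σ : Perm α, #{a | σ a = a} * fixedColorings σ m =
      if m.degree = Fintype.card α then #m.support * (Fintype.card α).factorial else 0 := by
  classical
  have := Fintype.ofFinite (Coloring α m)
  have hfix : ∀ σ : Perm α, #{a | σ a = a} * fixedColorings σ m =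
      Fintype.card (MulAction.fixedBy (α × Coloring α m) σ) := by
    intro σ
    rw [fixedColorings_eq, ← Fintype.card_subtype, ← Fintype.card_prod]
    refine Fintype.card_congr ⟨fun x => ⟨(x.1.1, x.2.1), Prod.ext x.1.2 x.2.2⟩,
      fun x => (⟨x.1.1, congrArg Prod.fst x.2⟩, ⟨x.1.2, congrArg Prod.snd x.2⟩),
      fun x => rfl, fun x => rfl⟩
  simp only [hfix]
  rw [MulAction.sum_card_fixedBy_eq_card_orbits_mul_card_group, Fintype.card_perm]
  split_ifs with hm
  · obtain ⟨c⟩ := exists_coloring hm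
    congr 1
    rw [← Fintype.card_coe]
    let F : Quotient (MulAction.orbitRel (Perm α) (α × Coloring α m)) → m.support :=
      Quotient.lift (fun x => ⟨x.2.1 x.1, x.2.mem_support x.1⟩) <| by
        rintro _ y ⟨σ, rfl⟩
        refine Subtype.ext ?_
        simp [Coloring.smul_val]
    refine Fintype.card_of_bijective (f := F) ⟨?_, ?_⟩
    · intro q r
      refine Quotient.inductionOn₂ q r fun x y h => Quotient.sound ?_
      obtain ⟨σ, h1, h2⟩ := y.2.exists_smul_eq_of_apply_eq x.2 y.1 x.1
        (congrArg Subtype.val h).symm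
      exact MulAction.orbitRel_apply.mpr ⟨σ, Prod.ext h1 h2⟩
    · rintro ⟨j, hj⟩
      have hj' := hj
      rw [Finsupp.mem_support_iff, ← c.2, colorCount_apply, ← Nat.pos_iff_ne_zero,
        Finset.card_pos] at hj'
      obtain ⟨a, ha⟩ := hj'
      exact ⟨Quotient.mk _ (a, c), Subtype.ext (Finset.mem_filter.mp ha).2⟩
  · have : IsEmpty (Coloring α m) := ⟨fun c => hm (c.2 ▸ degree_colorCount c.1)⟩
    rw [Fintype.card_eq_zero, zero_mul]

end Colorings

/-! ### Products of power sums over the cycles of a permutation -/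

section PowerSums

variable {R : Type*} [CommRing R]

/-- Expanding the product means choosing one variable from each factor. Nonzero exponents make the
choice recoverable from the monomials chosen. -/
lemma coeff_prod_pSym {I : Type*} [Fintype I] (k : I → ℕ) (hk : ∀ i, k i ≠ 0) (m : ℕ →₀ ℕ) :
    MvPowerSeries.coeff m (∏ i, pSym ℕ R (k i)) =
      (Nat.card {g : I → ℕ // ∑ i, Finsupp.single (g i) (k i) = m} : R) := by
  classical
  rw [MvPowerSeries.coeff_prod]
  have h1 : ∀ l : I →₀ ℕ →₀ ℕ, ∏ i, MvPowerSeries.coeff (l i) (pSym ℕ R (k i)) =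
      if ∀ i, ∃ j, l i = Finsupp.single j (k i) then 1 else 0 := by
    intro l
    have : ∀ i, MvPowerSeries.coeff (l i) (pSym ℕ R (k i)) =
      if ∃ j, l i = Finsupp.single j (k i) then 1 else 0 := fun i => rfl
    simp only [this]
    rw [Finset.prod_ite_zero]
    simp
  simp only [h1]
  rw [Finset.sum_boole]
  congr 1
  let F : {g : I → ℕ // ∑ i, Finsupp.single (g i) (k i) = m} →
      {l // l ∈ (univ.finsuppAntidiag m).filter fun l : I →₀ ℕ →₀ ℕ =>
        ∀ i, ∃ j, l i = Finsupp.single j (k i)} := fun g =>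
    ⟨Finsupp.equivFunOnFinite.symm fun i => Finsupp.single (g.1 i) (k i), by
      rw [Finset.mem_filter, Finset.mem_finsuppAntidiag]
      exact ⟨⟨g.2, Finset.subset_univ _⟩, fun i => ⟨g.1 i, rfl⟩⟩⟩
  have hF : Function.Bijective F := by
    constructor
    · intro g g' h
      refine Subtype.ext (funext fun i => ?_)
      exact Finsupp.single_left_injective (hk i) (DFunLike.congr_fun (congrArg Subtype.val h) i)
    · rintro ⟨l, hl⟩
      have hl' := hl
      rw [Finset.mem_filter, Finset.mem_finsuppAntidiag] at hl'
      choose g hg using hl'.2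
      refine ⟨⟨g, ?_⟩, Subtype.ext (Finsupp.ext fun i => (hg i).symm)⟩
      rw [← hl'.1.1]
      exact Finset.sum_congr rfl fun i _ => (hg i).symm
  rw [Nat.card_eq_of_bijective F hF, Nat.card_eq_fintype_card, Fintype.card_coe]

/-- The cycles of `σ`, including the trivial ones. -/
abbrev AllCycles {α : Type*} [Fintype α] [DecidableEq α] (σ : Perm α) : Type _ :=
  {c // c ∈ σ.cycleFactorsFinset} ⊕ {a // σ a = a}

/-- The length of a cycle. -/
def AllCycles.length {α : Type*} [Fintype α] [DecidableEq α] {σ : Perm α} : AllCycles σ → ℕ :=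
  Sum.elim (fun c => #c.1.support) fun _ => 1

/-- The cycle that contains a given element. -/
def AllCycles.of {α : Type*} [Fintype α] [DecidableEq α] (σ : Perm α) (a : α) : AllCycles σ :=
  if h : σ a = a then .inr ⟨a, h⟩ else
    .inl ⟨σ.cycleOf a, Perm.cycleOf_mem_cycleFactorsFinset_iff.mpr (Perm.mem_support.mpr h)⟩

variable {α : Type*} [Fintype α] [DecidableEq α]

lemma AllCycles.card_fiber {σ : Perm α} (i : AllCycles σ) : #{a | AllCycles.of σ a = i} = i.length := by
  rcases i with ⟨c, hc⟩ | ⟨b, hb⟩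
  · change _ = #c.support
    congr 1
    ext a
    rw [Finset.mem_filter_univ]
    simp only [AllCycles.of]
    constructor
    · intro h
      split_ifs at h with ha
      have h' : σ.cycleOf a = c := congrArg Subtype.val (Sum.inl_injective h)
      rw [← h', Perm.mem_support_cycleOf_iff]
      exact ⟨.refl _ _, Perm.mem_support.mpr ha⟩
    · intro h
      have h' := Perm.cycle_is_cycleOf h hc
      have ha : a ∈ σ.support := Perm.mem_cycleFactorsFinset_support_le hc h
      rw [dif_neg (Perm.mem_support.mp ha)]
      exact congrArg Sum.inl (Subtype.ext h'.symm)
  · change _ = 1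
    rw [Finset.card_eq_one]
    refine ⟨b, ?_⟩
    ext a
    rw [Finset.mem_filter_univ, Finset.mem_singleton]
    simp only [AllCycles.of]
    constructor
    · intro h
      split_ifs at h with ha
      exact congrArg Subtype.val (Sum.inr_injective h)
    · rintro rfl
      rw [dif_pos hb]

lemma AllCycles.length_ne_zero {σ : Perm α} (i : AllCycles σ) : i.length ≠ 0 := by
  rcases i with ⟨c, hc⟩ | ⟨b, hb⟩
  · exact (Perm.IsCycle.two_le_card_support (Perm.mem_cycleFactorsFinset_iff.mp hc).1).trans_lt'
      Nat.zero_lt_two |>.ne'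
  · exact one_ne_zero

lemma AllCycles.of_surjective (σ : Perm α) : Function.Surjective (AllCycles.of σ) := by
  intro i
  obtain ⟨a, ha⟩ := Finset.card_pos.mp
    ((AllCycles.card_fiber i).symm ▸ Nat.pos_of_ne_zero i.length_ne_zero)
  exact ⟨a, (Finset.mem_filter.mp ha).2⟩

lemma AllCycles.of_apply (σ : Perm α) (a : α) : AllCycles.of σ (σ a) = AllCycles.of σ a := by
  by_cases h : σ a = a
  · rw [h]
  · have h' : σ (σ a) ≠ σ a := fun e => h (σ.injective e)
    simp only [AllCycles.of, dif_neg h, dif_neg h']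
    exact congrArg Sum.inl (Subtype.ext (Perm.sameCycle_apply_left.mpr (.refl _ _)).cycleOf_eq)

lemma AllCycles.sameCycle {σ : Perm α} {a b : α} (h : AllCycles.of σ a = AllCycles.of σ b) :
    σ.SameCycle a b := by
  simp only [AllCycles.of] at h
  split_ifs at h with ha hb hb
  · have : a = b := congrArg Subtype.val (Sum.inr_injective h)
    exact this ▸ .refl _ _
  · have h' : σ.cycleOf a = σ.cycleOf b := congrArg Subtype.val (Sum.inl_injective h)
    have : a ∈ (σ.cycleOf b).support := by
      rw [← h', Perm.mem_support_cycleOf_iff]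
      exact ⟨.refl _ _, Perm.mem_support.mpr ha⟩
    exact (Perm.mem_support_cycleOf_iff.mp this).1.symm

omit [DecidableEq α] in
lemma comp_perm_eq_of_sameCycle {β : Type*} {σ : Perm α} {c : α → β} (hc : c ∘ σ = c) {a b : α}
    (h : σ.SameCycle a b) : c a = c b := by
  obtain ⟨k, rfl⟩ := h.exists_nat_pow_eq
  induction k with
  | zero => rfl
  | succ k ih =>
    rw [pow_succ', Perm.mul_apply]
    exact (ih ⟨k, by simp⟩).trans (congrFun hc _).symm

lemma prod_parts_partition {M : Type*} [CommMonoid M] (p : ℕ → M) (σ : Perm α) :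
    (σ.partition.parts.map p).prod = ∏ i : AllCycles σ, p i.length := by
  rw [Perm.parts_partition, Perm.cycleType_def, Multiset.map_add, Multiset.prod_add,
    Multiset.map_map, Fintype.prod_sum_type]
  congr 1
  · exact (Finset.prod_coe_sort σ.cycleFactorsFinset fun c => p #c.support).symm
  · rw [Multiset.map_replicate, Multiset.prod_replicate]
    change _ = ∏ _ : {a // σ a = a}, p 1
    rw [Finset.prod_const, Finset.card_univ, Fintype.card_subtype]
    congr 1
    rw [← Finset.card_compl]
    congr 1
    ext a
    simp

/-- A colouring is invariant under `σ` exactly when it is constant on cycles; a cycle of length `k`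
with colour `j` contributes the monomial `w_j ^ k`. -/
lemma coeff_prod_pSym_partition (σ : Perm α) (m : ℕ →₀ ℕ) :
    MvPowerSeries.coeff m (σ.partition.parts.map (pSym ℕ R)).prod = (fixedColorings σ m : R) := by
  classical
  rw [prod_parts_partition, coeff_prod_pSym _ fun i => i.length_ne_zero]
  congr 1
  have hcount : ∀ g : AllCycles σ → ℕ, colorCount (g ∘ AllCycles.of σ) =
      ∑ i : AllCycles σ, Finsupp.single (g i) i.length := by
    intro g
    rw [colorCount, ← Finset.sum_fiberwise univ (AllCycles.of σ)]
    refine Finset.sum_congr rfl fun i _ => ?_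
    rw [Finset.sum_congr rfl (g := fun _ => Finsupp.single (g i) 1), Finset.sum_const,
      AllCycles.card_fiber, Finsupp.smul_single, smul_eq_mul, mul_one]
    intro a ha
    rw [← (Finset.mem_filter.mp ha).2]
    rfl
  let F : {g : AllCycles σ → ℕ // ∑ i, Finsupp.single (g i) i.length = m} →
      {c : Coloring α m // c.1 ∘ σ = c.1} := fun g =>
    ⟨⟨g.1 ∘ AllCycles.of σ, (hcount g.1).trans g.2⟩,
      funext fun a => congrArg g.1 (AllCycles.of_apply σ a)⟩
  refine Nat.card_eq_of_bijective F ⟨?_, ?_⟩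
  · intro g g' h
    refine Subtype.ext ?_
    have h' : g.1 ∘ AllCycles.of σ = g'.1 ∘ AllCycles.of σ :=
      congrArg (fun c => c.1.1) h
    exact (AllCycles.of_surjective σ).injective_comp_right h'
  · rintro ⟨⟨c, hm⟩, hc⟩
    have hfac : c.FactorsThrough (AllCycles.of σ) := fun a b h =>
      comp_perm_eq_of_sameCycle hc (AllCycles.sameCycle h)
    have hcomp : Function.extend (AllCycles.of σ) c 0 ∘ AllCycles.of σ = c :=
      funext fun a => hfac.extend_apply 0 a
    refine ⟨⟨Function.extend (AllCycles.of σ) c 0, ?_⟩, ?_⟩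
    · rw [← hcount, hcomp, hm]
    · exact Subtype.ext (Subtype.ext hcomp)

end PowerSums

/-! ### Frobenius characteristics of permutation representations -/

section Frobenius

lemma coeff_hSym {ι R : Type*} [CommRing R] (k : ℕ) (m : ι →₀ ℕ) :
    MvPowerSeries.coeff m (hSym ι R k) = if m.degree = k then 1 else 0 := rfl

lemma hSym_zero (ι R : Type*) [CommRing R] : hSym ι R 0 = 1 := by
  classical
  ext m
  rw [coeff_hSym, MvPowerSeries.coeff_one]
  simp [Finsupp.degree_eq_zero_iff]

/-- A monomial of degree `n` arises once for each of its variables that can be supplied by the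
factor `h_1`. -/
lemma coeff_hSym_mul_hSym_one {n : ℕ} (hn : 1 ≤ n) (m : ℕ →₀ ℕ) :
    MvPowerSeries.coeff m (hSym ℕ ℝ (n - 1) * hSym ℕ ℝ 1) =
      if m.degree = n then (#m.support : ℝ) else 0 := by
  classical
  rw [MvPowerSeries.coeff_mul]
  simp only [coeff_hSym, ← ite_and, mul_ite, mul_one, mul_zero]
  rw [Finset.sum_boole]
  split_ifs with hm
  · congr 1
    symm
    refine Finset.card_bij (fun j _ => (m - Finsupp.single j 1, Finsupp.single j 1)) ?_ ?_ ?_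
    · intro j hj
      have hle : Finsupp.single j 1 ≤ m :=
        Finsupp.single_le_iff.mpr (Nat.one_le_iff_ne_zero.mpr (Finsupp.mem_support_iff.mp hj))
      have hadd := tsub_add_cancel_of_le hle
      have hdeg := congrArg Finsupp.degree hadd
      rw [map_add, Finsupp.degree_single, hm] at hdeg
      rw [Finset.mem_filter, Finset.HasAntidiagonal.mem_antidiagonal]
      exact ⟨hadd, Finsupp.degree_single _ _, by simp only; omega⟩
    · intro i _ j _ h
      exact Finsupp.single_left_injective one_ne_zero (Prod.ext_iff.mp h).2
    · rintro ⟨x, y⟩ h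
      rw [Finset.mem_filter, Finset.HasAntidiagonal.mem_antidiagonal] at h
      obtain ⟨hxy, hy, hx⟩ := h
      obtain ⟨j, rfl⟩ : ∃ j, Finsupp.single j 1 = y := by
        have : y ∈ {d : ℕ →₀ ℕ | d.degree = 1} := hy
        rwa [← Finsupp.range_single_one] at this
      have hxy' : x + Finsupp.single j 1 = m := hxy
      refine ⟨j, ?_, ?_⟩
      · rw [← hxy']
        simp
      · rw [← hxy', add_tsub_cancel_right]
  · rw [Nat.cast_eq_zero, Finset.card_eq_zero, Finset.filter_eq_empty_iff]
    rintro ⟨x, y⟩ h ⟨hy, hx⟩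
    rw [Finset.HasAntidiagonal.mem_antidiagonal] at h
    simp only at h hx hy
    rw [← h, map_add] at hm
    omega

/-- The Frobenius characteristic of the permutation representation on `ι`. -/
def permFrob (n : ℕ) {ι : Type*} [Fintype ι] [DecidableEq ι] (act : Perm (Fin n) → ι → ι) :
    MvPowerSeries ℕ ℝ :=
  (n.factorial : ℝ)⁻¹ • ∑ σ : Perm (Fin n), (#{i | act σ i = i} : ℝ) •
    (σ.partition.parts.map (pSym ℕ ℝ)).prod

lemma permFrob_unit (n : ℕ) : permFrob n (fun _ (i : Unit) => i) = hSymPart ℕ ℝ [n] := by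
  ext m
  have h := congrArg (Nat.cast (R := ℝ)) (sum_fixedColorings (α := Fin n) m)
  simp only [Fintype.card_fin, Nat.cast_sum] at h
  simp only [permFrob, map_smul, map_sum, coeff_prod_pSym_partition, hSymPart, List.map_cons,
    List.map_nil, List.prod_cons, List.prod_nil, mul_one, coeff_hSym, Finset.filter_true,
    Finset.card_univ, Fintype.card_unit, Nat.cast_one, one_smul, h]
  split_ifs
  · simp [Nat.factorial_ne_zero]
  · simp

lemma permFrob_fin {n : ℕ} (hn : 1 ≤ n) :
    permFrob n (fun σ (i : Fin n) => σ i) = hSymPart ℕ ℝ [n - 1, 1] := by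
  ext m
  have h := congrArg (Nat.cast (R := ℝ)) (sum_card_fixed_mul_fixedColorings (α := Fin n) m)
  simp only [Fintype.card_fin, Nat.cast_sum, Nat.cast_mul] at h
  simp only [permFrob, map_smul, map_sum, coeff_prod_pSym_partition, hSymPart, List.map_cons,
    List.map_nil, List.prod_cons, List.prod_nil, mul_one, coeff_hSym_mul_hSym_one hn, smul_eq_mul, h]
  split_ifs
  · field_simp
    push_cast
    ring
  · simp

lemma permFrob_option {n : ℕ} (hn : 1 ≤ n) :
    permFrob n (fun σ (i : Option (Fin n)) => i.map σ) =
      hSymPart ℕ ℝ [n] + hSymPart ℕ ℝ [n - 1, 1] := by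
  rw [← permFrob_unit, ← permFrob_fin hn, permFrob, permFrob, permFrob, ← smul_add,
    ← Finset.sum_add_distrib]
  congr 1
  refine Finset.sum_congr rfl fun σ _ => ?_
  rw [← add_smul]
  congr 1
  rw [← Nat.cast_add]
  congr 1
  rw [Finset.card_filter, Finset.card_filter, Finset.card_filter, Fintype.sum_option]
  simp

end Frobenius

end Polarization
end

noncomputable section
namespace Polarization

open Equiv Finset MvPolynomial

variable {ℓ n : ℕ}

/-! ### Characters and graded pieces from permuted homogeneous bases -/

section Characters

/-- In the basis `v` each column of the matrix of `σ` is a unit vector, so the trace counts fixed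
labels. -/
lemma character_eq_card_fixed (V : Subrepresentation (diagAction ℓ n)) {ι : Type*} [Fintype ι]
    [DecidableEq ι] {v : ι → MatPoly ℓ n} (hv : LinearIndependent ℝ v)
    (hV : V.toSubmodule = Submodule.span ℝ (Set.range v)) {act : Perm (Fin n) → ι → ι}
    (hact : ∀ σ i, diagAction ℓ n σ (v i) = v (act σ i)) (σ : Perm (Fin n)) :
    V.toRepresentation.character σ = #{i | act σ i = i} := by
  let b : Module.Basis ι ℝ V.toSubmodule :=
    (Module.Basis.span hv).map (LinearEquiv.ofEq _ _ hV.symm)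
  have hb : ∀ i, ((b i : V.toSubmodule) : MatPoly ℓ n) = v i := by
    intro i
    simp [b, Module.Basis.span_apply]
  have hσ : ∀ i, V.toRepresentation σ (b i) = b (act σ i) := by
    intro i
    refine Subtype.ext ?_
    rw [hb, ← hact, ← hb]
    rfl
  rw [Representation.character, LinearMap.trace_eq_matrix_trace ℝ b, Matrix.trace]
  simp only [Matrix.diag_apply, LinearMap.toMatrix_apply, hσ, Module.Basis.repr_self,
    Finsupp.single_apply]
  rw [Finset.sum_boole]

lemma coeff_frobChar_eq_permFrob (V : Subrepresentation (diagAction ℓ n)) (d : Fin ℓ →₀ ℕ)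
    {ι : Type*} [Fintype ι] [DecidableEq ι] {v : ι → MatPoly ℓ n} (hv : LinearIndependent ℝ v)
    (hV : (V ⊓ degreePart ℓ n d).toSubmodule = Submodule.span ℝ (Set.range v))
    {act : Perm (Fin n) → ι → ι} (hact : ∀ σ i, diagAction ℓ n σ (v i) = v (act σ i)) :
    MvPowerSeries.coeff d (frobChar V) = permFrob n act := by
  change (n.factorial : ℝ)⁻¹ • ∑ σ : Perm (Fin n),
    (V ⊓ degreePart ℓ n d).toRepresentation.character σ •
      (σ.partition.parts.map (pSym ℕ ℝ)).prod = _
  simp only [character_eq_card_fixed _ hv hV hact]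
  rfl

/-- The vector degree of the variable `x_{ij}`. -/
abbrev rowWeight (ℓ n : ℕ) (x : Fin ℓ × Fin n) : Fin ℓ →₀ ℕ := Finsupp.single x.1 1

/-- Projection to degree `d` fixes the generators of that degree and kills all others. -/
lemma span_inf_degreePart {ι : Type*} (g : ι → MatPoly ℓ n) (deg : ι → Fin ℓ →₀ ℕ)
    (hg : ∀ i, IsWeightedHomogeneous (rowWeight ℓ n) (g i) (deg i)) (d : Fin ℓ →₀ ℕ) :
    Submodule.span ℝ (Set.range g) ⊓ (degreePart ℓ n d).toSubmodule =
      Submodule.span ℝ (g '' {i | deg i = d}) := by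
  classical
  apply le_antisymm
  · rintro x ⟨hx, hd⟩
    have hxd : weightedHomogeneousComponent (rowWeight ℓ n) d x = x := by
      rw [weightedHomogeneousComponent_of_mem (n := d) hd, if_pos rfl]
    rw [← hxd]
    have hmem := Submodule.mem_map_of_mem (f := weightedHomogeneousComponent (rowWeight ℓ n) d) hx
    rw [Submodule.map_span] at hmem
    refine Submodule.span_le.mpr ?_ hmem
    rintro _ ⟨_, ⟨i, rfl⟩, rfl⟩
    rw [weightedHomogeneousComponent_of_mem (n := deg i)
      ((mem_weightedHomogeneousSubmodule ..).mpr (hg i))]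
    split_ifs with h
    · exact Submodule.subset_span ⟨i, h.symm, rfl⟩
    · exact Submodule.zero_mem _
  · rw [Submodule.span_le]
    rintro _ ⟨i, rfl, rfl⟩
    exact ⟨Submodule.subset_span ⟨i, rfl⟩, (mem_weightedHomogeneousSubmodule ..).mpr (hg i)⟩

end Characters

/-! ### Linear, bilinear and trilinear forms under derivatives and polarization -/

section Forms

/-- The linear form with coefficients `L j`, in the variables of row `a`. -/
def lin (a : Fin ℓ) : (Fin n → ℝ) →ₗ[ℝ] MatPoly ℓ n :=
  ∑ j, (LinearMap.proj j).smulRight (X (a, j))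

/-- The bilinear form with coefficients `Q j k`, in the variables of rows `a` and `b`. -/
def quad (a b : Fin ℓ) : (Fin n → Fin n → ℝ) →ₗ[ℝ] MatPoly ℓ n :=
  ∑ j, LinearMap.mulLeft ℝ (X (a, j)) ∘ₗ lin b ∘ₗ LinearMap.proj j

/-- The trilinear form with coefficients `T j k m`, in the variables of rows `a`, `b` and `c`. -/
def cub (a b c : Fin ℓ) : (Fin n → Fin n → Fin n → ℝ) →ₗ[ℝ] MatPoly ℓ n :=
  ∑ j, LinearMap.mulLeft ℝ (X (a, j)) ∘ₗ quad b c ∘ₗ LinearMap.proj j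

lemma lin_apply (a : Fin ℓ) (L : Fin n → ℝ) : lin a L = ∑ j, C (L j) * X (a, j) := by
  simp [lin, MvPolynomial.C_mul']

lemma lin_apply' (a : Fin ℓ) (L : Fin n → ℝ) : lin a L = ∑ j, X (a, j) * C (L j) := by
  simp only [lin_apply, mul_comm]

lemma quad_apply (a b : Fin ℓ) (Q : Fin n → Fin n → ℝ) :
    quad a b Q = ∑ j, X (a, j) * lin b (Q j) := by
  simp [quad]

lemma cub_apply (a b c : Fin ℓ) (T : Fin n → Fin n → Fin n → ℝ) :
    cub a b c T = ∑ j, X (a, j) * quad b c (T j) := by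
  simp [cub]

/-- Symmetric matrices. -/
def IsSymm₂ (Q : Fin n → Fin n → ℝ) : Prop := ∀ j k, Q j k = Q k j

/-- Symmetric tensors of order three. -/
def IsSymm₃ (T : Fin n → Fin n → Fin n → ℝ) : Prop :=
  (∀ j k m, T j k m = T k j m) ∧ ∀ j k m, T j k m = T j m k

lemma IsSymm₃.isSymm₂ {T : Fin n → Fin n → Fin n → ℝ} (hT : IsSymm₃ T) (j : Fin n) :
    IsSymm₂ (T j) := hT.2 j

lemma quad_transpose (a b : Fin ℓ) (Q : Fin n → Fin n → ℝ) :
    quad a b Q = quad b a fun j k => Q k j := by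
  simp only [quad_apply, lin_apply, Finset.mul_sum]
  rw [Finset.sum_comm]
  exact Finset.sum_congr rfl fun _ _ => Finset.sum_congr rfl fun _ _ => by ring

lemma quad_comm {Q : Fin n → Fin n → ℝ} (hQ : IsSymm₂ Q) (a b : Fin ℓ) :
    quad a b Q = quad b a Q := by
  rw [quad_transpose]
  exact congrArg _ (funext₂ fun j k => hQ k j)

lemma cub_comm_right {T : Fin n → Fin n → Fin n → ℝ} (hT : IsSymm₃ T) (a b c : Fin ℓ) :
    cub a b c T = cub a c b T := by
  simp only [cub_apply, quad_comm (hT.isSymm₂ _) b c]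

lemma cub_comm_left {T : Fin n → Fin n → Fin n → ℝ} (hT : IsSymm₃ T) (a b c : Fin ℓ) :
    cub a b c T = cub b a c T := by
  simp only [cub_apply, quad_apply, Finset.mul_sum]
  rw [Finset.sum_comm]
  refine Finset.sum_congr rfl fun j _ => Finset.sum_congr rfl fun k _ => ?_
  rw [show T k j = T j k from funext fun m => hT.1 k j m]
  ring

variable (r : Fin ℓ) (j : Fin n)

lemma partialD_apply (g : MatPoly ℓ n) : partialD r j g = pderiv (r, j) g := rfl

lemma partialD_X (a : Fin ℓ) (k : Fin n) :
    partialD r j (X (a, k)) = if a = r ∧ k = j then 1 else 0 := by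
  rw [partialD_apply, pderiv_X, Pi.single_apply]
  simp only [Prod.mk.injEq]

lemma partialD_C (s : ℝ) : partialD r j (C s) = 0 := by
  rw [partialD_apply, pderiv_C]

lemma partialD_mul (p q : MatPoly ℓ n) :
    partialD r j (p * q) = p * partialD r j q + partialD r j p * q := by
  simp only [partialD_apply, Derivation.leibniz, smul_eq_mul]
  ring

/-- The Kronecker delta. -/
def kron (a r : Fin ℓ) : ℝ := if a = r then 1 else 0

lemma sum_partialD_X_mul (a : Fin ℓ) (p : Fin n → MatPoly ℓ n) :
    ∑ k, partialD r j (X (a, k)) * p k = kron a r • p j := by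
  simp only [partialD_X, ite_and, kron]
  split_ifs with h <;> simp

lemma partialD_lin (a : Fin ℓ) (L : Fin n → ℝ) :
    partialD r j (lin a L) = kron a r • C (L j) := by
  rw [lin_apply', map_sum]
  simp only [partialD_mul, partialD_C, mul_zero, zero_add]
  exact sum_partialD_X_mul r j a fun k => C (L k)

lemma partialD_quad {Q : Fin n → Fin n → ℝ} (hQ : IsSymm₂ Q) (a b : Fin ℓ) :
    partialD r j (quad a b Q) = kron a r • lin b (Q j) + kron b r • lin a (Q j) := by
  rw [quad_apply, map_sum]
  simp only [partialD_mul, Finset.sum_add_distrib]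
  rw [sum_partialD_X_mul r j a fun k => lin b (Q k), add_comm]
  congr 1
  rw [lin_apply', Finset.smul_sum]
  simp only [partialD_lin, hQ j, mul_smul_comm]

lemma partialD_cub {T : Fin n → Fin n → Fin n → ℝ} (hT : IsSymm₃ T) (a b c : Fin ℓ) :
    partialD r j (cub a b c T) = kron a r • quad b c (T j) + kron b r • quad a c (T j) +
      kron c r • quad a b (T j) := by
  rw [cub_apply, map_sum]
  simp only [partialD_mul, Finset.sum_add_distrib]
  rw [sum_partialD_X_mul r j a fun k => quad b c (T k), add_comm, add_assoc]
  congr 1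
  rw [quad_apply, quad_apply, Finset.smul_sum, Finset.smul_sum, ← Finset.sum_add_distrib]
  refine Finset.sum_congr rfl fun k _ => ?_
  rw [partialD_quad r j (hT.isSymm₂ k), mul_add, mul_smul_comm, mul_smul_comm,
    show T k j = T j k from funext fun m => hT.1 k j m]

variable {j}

lemma polOp_apply (i k : Fin ℓ) (p : ℕ) (g : MatPoly ℓ n) :
    polOp i k p g = ∑ j, X (i, j) * (partialD k j ^ p) g := by
  simp [polOp]

variable (i : Fin ℓ)

lemma polOp_C (p : ℕ) (s : ℝ) : polOp i r (p + 1) (C s : MatPoly ℓ n) = 0 := by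
  simp [polOp_apply, pow_succ, partialD_C]

lemma polOp_one_lin (a : Fin ℓ) (L : Fin n → ℝ) :
    polOp i r 1 (lin a L) = kron a r • lin i L := by
  simp only [polOp_apply, pow_one, partialD_lin, mul_smul_comm, ← Finset.smul_sum, ← lin_apply']

lemma polOp_add_two_lin (p : ℕ) (a : Fin ℓ) (L : Fin n → ℝ) :
    polOp i r (p + 2) (lin a L) = 0 := by
  simp [polOp_apply, pow_succ, partialD_lin, partialD_C]

lemma polOp_one_quad {Q : Fin n → Fin n → ℝ} (hQ : IsSymm₂ Q) (a b : Fin ℓ) :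
    polOp i r 1 (quad a b Q) = kron a r • quad i b Q + kron b r • quad i a Q := by
  simp only [polOp_apply, pow_one, partialD_quad r _ hQ, mul_add, mul_smul_comm,
    Finset.sum_add_distrib, ← Finset.smul_sum, ← quad_apply]

lemma polOp_two_quad {Q : Fin n → Fin n → ℝ} (hQ : IsSymm₂ Q) (a b : Fin ℓ) :
    polOp i r 2 (quad a b Q) = (2 * kron a r * kron b r) • lin i fun j => Q j j := by
  simp only [polOp_apply, pow_succ, pow_zero, one_mul, Module.End.mul_apply, partialD_quad r _ hQ,
    map_add, map_smul, partialD_lin, smul_smul, ← add_smul, mul_smul_comm, ← Finset.smul_sum,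
    ← lin_apply']
  congr 1
  ring

lemma polOp_add_three_quad (p : ℕ) {Q : Fin n → Fin n → ℝ} (hQ : IsSymm₂ Q) (a b : Fin ℓ) :
    polOp i r (p + 3) (quad a b Q) = 0 := by
  simp [polOp_apply, pow_succ, partialD_quad r _ hQ, partialD_lin, partialD_C]

lemma polOp_one_cub {T : Fin n → Fin n → Fin n → ℝ} (hT : IsSymm₃ T) (a b c : Fin ℓ) :
    polOp i r 1 (cub a b c T) =
      kron a r • cub i b c T + kron b r • cub i a c T + kron c r • cub i a b T := by
  simp only [polOp_apply, pow_one, partialD_cub r _ hT, mul_add, mul_smul_comm,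
    Finset.sum_add_distrib, ← Finset.smul_sum, ← cub_apply]

lemma polOp_two_cub {T : Fin n → Fin n → Fin n → ℝ} (hT : IsSymm₃ T) (a b c : Fin ℓ) :
    polOp i r 2 (cub a b c T) = (2 * kron a r * kron b r) • quad i c (fun j => T j j) +
      (2 * kron a r * kron c r) • quad i b (fun j => T j j) +
      (2 * kron b r * kron c r) • quad i a (fun j => T j j) := by
  have h : ∀ j, (partialD r j ^ 2) (cub a b c T) = (2 * kron a r * kron b r) • lin c (T j j) +
      (2 * kron a r * kron c r) • lin b (T j j) + (2 * kron b r * kron c r) • lin a (T j j) := by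
    intro j
    simp only [pow_two, Module.End.mul_apply, partialD_cub r _ hT, map_add, map_smul,
      partialD_quad r _ (hT.isSymm₂ _)]
    module
  simp only [polOp_apply, h, mul_add, mul_smul_comm, Finset.sum_add_distrib, ← Finset.smul_sum,
    quad_apply]

lemma polOp_three_cub {T : Fin n → Fin n → Fin n → ℝ} (hT : IsSymm₃ T) (a b c : Fin ℓ) :
    polOp i r 3 (cub a b c T) =
      (6 * kron a r * kron b r * kron c r) • lin i fun j => T j j j := by
  have h : ∀ j, (partialD r j ^ 3) (cub a b c T) =
      (6 * kron a r * kron b r * kron c r) • C (T j j j) := by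
    intro j
    simp only [pow_succ, pow_zero, one_mul, Module.End.mul_apply, partialD_cub r _ hT, map_add,
      map_smul, partialD_quad r _ (hT.isSymm₂ _), partialD_lin]
    module
  simp only [polOp_apply, h, mul_smul_comm, ← Finset.smul_sum, ← lin_apply']

lemma polOp_add_four_cub (p : ℕ) {T : Fin n → Fin n → Fin n → ℝ} (hT : IsSymm₃ T) (a b c : Fin ℓ) :
    polOp i r (p + 4) (cub a b c T) = 0 := by
  simp [polOp_apply, pow_succ, partialD_cub r _ hT, partialD_quad r _ (hT.isSymm₂ _), partialD_lin,
    partialD_C]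

lemma isWeightedHomogeneous_lin (a : Fin ℓ) (L : Fin n → ℝ) :
    IsWeightedHomogeneous (rowWeight ℓ n) (lin a L) (Finsupp.single a 1) := by
  rw [lin_apply]
  refine IsWeightedHomogeneous.sum _ _ _ fun j _ => ?_
  simpa using (isWeightedHomogeneous_C (rowWeight ℓ n) (L j)).mul
    (isWeightedHomogeneous_X ℝ (rowWeight ℓ n) (a, j))

lemma isWeightedHomogeneous_quad (a b : Fin ℓ) (Q : Fin n → Fin n → ℝ) :
    IsWeightedHomogeneous (rowWeight ℓ n) (quad a b Q)
      (Finsupp.single a 1 + Finsupp.single b 1) := by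
  rw [quad_apply]
  exact IsWeightedHomogeneous.sum _ _ _ fun j _ =>
    (isWeightedHomogeneous_X ℝ (rowWeight ℓ n) (a, j)).mul (isWeightedHomogeneous_lin b _)

lemma isWeightedHomogeneous_cub (a b c : Fin ℓ) (T : Fin n → Fin n → Fin n → ℝ) :
    IsWeightedHomogeneous (rowWeight ℓ n) (cub a b c T)
      (Finsupp.single a 1 + (Finsupp.single b 1 + Finsupp.single c 1)) := by
  rw [cub_apply]
  exact IsWeightedHomogeneous.sum _ _ _ fun j _ =>
    (isWeightedHomogeneous_X ℝ (rowWeight ℓ n) (a, j)).mul (isWeightedHomogeneous_quad b c _)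

lemma diagAction_mul (σ : Perm (Fin n)) (p q : MatPoly ℓ n) :
    diagAction ℓ n σ (p * q) = diagAction ℓ n σ p * diagAction ℓ n σ q :=
  map_mul (rename (Prod.map id σ)) p q

lemma diagAction_X (σ : Perm (Fin n)) (a : Fin ℓ) (j : Fin n) :
    diagAction ℓ n σ (X (a, j)) = X (a, σ j) :=
  rename_X (Prod.map id σ) (a, j)

lemma diagAction_C (σ : Perm (Fin n)) (s : ℝ) : diagAction ℓ n σ (C s) = C s :=
  rename_C (Prod.map id σ) s

lemma diagAction_lin (σ : Perm (Fin n)) (a : Fin ℓ) (L : Fin n → ℝ) :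
    diagAction ℓ n σ (lin a (L ∘ σ)) = lin a L := by
  simp only [lin_apply, map_sum, diagAction_mul, diagAction_X, diagAction_C, Function.comp_apply]
  exact Equiv.sum_comp σ fun j => C (L j) * (X (a, j) : MatPoly ℓ n)

lemma diagAction_quad (σ : Perm (Fin n)) (a b : Fin ℓ) (Q : Fin n → Fin n → ℝ) :
    diagAction ℓ n σ (quad a b fun j k => Q (σ j) (σ k)) = quad a b Q := by
  simp only [quad_apply, map_sum, diagAction_mul, diagAction_X]
  rw [← Equiv.sum_comp σ fun j => X (a, j) * lin b (Q j)]
  exact Finset.sum_congr rfl fun j _ => congrArg _ (diagAction_lin σ b (Q (σ j)))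

lemma diagAction_cub (σ : Perm (Fin n)) (a b c : Fin ℓ) (T : Fin n → Fin n → Fin n → ℝ) :
    diagAction ℓ n σ (cub a b c fun j k m => T (σ j) (σ k) (σ m)) = cub a b c T := by
  simp only [cub_apply, map_sum, diagAction_mul, diagAction_X]
  rw [← Equiv.sum_comp σ fun j => X (a, j) * quad b c (T j)]
  exact Finset.sum_congr rfl fun j _ => congrArg _ (diagAction_quad σ b c (T (σ j)))

lemma kron_self (a : Fin ℓ) : kron a a = 1 := if_pos rfl

lemma kron_of_ne {a r : Fin ℓ} (h : a ≠ r) : kron a r = 0 := if_neg h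

lemma eq_zero_of_lin_eq_zero {a : Fin ℓ} {L : Fin n → ℝ} (h : lin a L = 0) : L = 0 := by
  funext j
  have := partialD_lin a j a L
  rw [h, map_zero, kron_self, one_smul] at this
  exact C_eq_zero.mp this.symm

/-- The substitution that identifies all rows with the row `r`. -/
def collapse (ℓ n : ℕ) (r : Fin ℓ) : MatPoly ℓ n →ₐ[ℝ] MatPoly ℓ n :=
  rename (Prod.map (fun _ => r) id)

lemma collapse_quad (a b : Fin ℓ) (Q : Fin n → Fin n → ℝ) :
    collapse ℓ n r (quad a b Q) = quad r r Q := by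
  simp [quad_apply, lin_apply, collapse]

lemma collapse_cub (a b c : Fin ℓ) (T : Fin n → Fin n → Fin n → ℝ) :
    collapse ℓ n r (cub a b c T) = cub r r r T := by
  simp [cub_apply, quad_apply, lin_apply, collapse]

/-- Identifying rows reduces to `a = b`, where the derivatives are twice the rows of `Q`. Symmetry
is needed there, since `quad a a` kills antisymmetric matrices. -/
lemma eq_zero_of_quad_eq_zero {a b : Fin ℓ} {Q : Fin n → Fin n → ℝ} (hQ : IsSymm₂ Q)
    (h : quad a b Q = 0) : Q = 0 := by
  have h' := collapse_quad a a b Q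
  rw [h, map_zero] at h'
  funext j
  have := partialD_quad a j hQ a a
  rw [← h', map_zero, kron_self, one_smul, ← map_add, eq_comm] at this
  have h2 := eq_zero_of_lin_eq_zero this
  funext k
  have := congrFun h2 k
  simpa using this

lemma cub_ne_zero_of_cub_ne_zero {a b c : Fin ℓ} {T : Fin n → Fin n → Fin n → ℝ}
    (h : cub r r r T ≠ 0) : cub a b c T ≠ 0 := by
  intro h'
  rw [← collapse_cub r a b c, h', map_zero] at h
  exact h rfl

end Forms

end Polarization
end

noncomputable section
namespace Polarization

open Equiv Finset MvPolynomial

variable {ℓ n : ℕ}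

/-! ### Spreading forms over all rows by ordinary polarization -/

section Closure

lemma isClosedUnder_polClosure (F : Set (MatPoly ℓ n)) : IsClosedUnder (polClosure F) := by
  refine ⟨fun i j g hg => ?_, fun i k p hp g hg => ?_⟩ <;>
    simp only [polClosure, Submodule.mem_sInf, Set.mem_ofPred_eq] at hg ⊢ <;> intro V hV
  · exact hV.2.1 _ _ _ (hg V hV)
  · exact hV.2.2 _ _ _ hp _ (hg V hV)

lemma subset_polClosure (F : Set (MatPoly ℓ n)) : F ⊆ polClosure F := by
  intro g hg
  simp only [polClosure, SetLike.mem_coe, Submodule.mem_sInf, Set.mem_ofPred_eq]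
  exact fun V hV => hV.1 hg

lemma polClosure_le {F : Set (MatPoly ℓ n)} {V : Submodule ℝ (MatPoly ℓ n)} (hF : F ⊆ V)
    (hV : IsClosedUnder V) : polClosure F ≤ V :=
  sInf_le ⟨hF, hV⟩

variable {M : Submodule ℝ (MatPoly ℓ n)} (hM : IsClosedUnder M)
include hM

lemma IsClosedUnder.lin_mem {r : Fin ℓ} {L : Fin n → ℝ} (h : lin r L ∈ M) (a : Fin ℓ) :
    lin a L ∈ M := by
  simpa [polOp_one_lin, kron_self] using hM.2 a r 1 le_rfl _ h

/-- `E_{a,r}^{(1)}` replaces the occurrences of row `r` one at a time. The case `a = r` is separate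
because `E_{b,r}^{(1)}` would then act on both factors. -/
lemma IsClosedUnder.quad_mem {r : Fin ℓ} {Q : Fin n → Fin n → ℝ} (hQ : IsSymm₂ Q)
    (h : quad r r Q ∈ M) (a b : Fin ℓ) : quad a b Q ∈ M := by
  have h1 : ∀ a, quad a r Q ∈ M := by
    intro a
    have := hM.2 a r 1 le_rfl _ h
    rw [polOp_one_quad r a hQ, kron_self, one_smul, ← two_smul ℝ] at this
    exact (M.smul_mem_iff two_ne_zero).mp this
  by_cases ha : a = r
  · rw [ha, quad_comm hQ]
    exact h1 b
  · have := hM.2 b r 1 le_rfl _ (h1 a)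
    rw [polOp_one_quad r b hQ, kron_self, kron_of_ne ha, zero_smul, zero_add, one_smul] at this
    rwa [quad_comm hQ]

/-- Rows equal to `r` are replaced one at a time. The first two replacements have multiplicity three
and two, divided out below; rows that stay equal to `r` are handled by symmetry of `T`. -/
lemma IsClosedUnder.cub_mem {r : Fin ℓ} {T : Fin n → Fin n → Fin n → ℝ} (hT : IsSymm₃ T)
    (h : cub r r r T ∈ M) (a b c : Fin ℓ) : cub a b c T ∈ M := by
  have h1 : ∀ a, cub a r r T ∈ M := by
    intro a
    have := hM.2 a r 1 le_rfl _ h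
    rw [polOp_one_cub r a hT, kron_self, one_smul] at this
    rw [show cub a r r T = (3⁻¹ : ℝ) • (cub a r r T + cub a r r T + cub a r r T) by module]
    exact M.smul_mem _ this
  have h2 : ∀ a b, cub a b r T ∈ M := by
    intro a b
    by_cases ha : a = r
    · rw [ha, cub_comm_left hT]
      exact h1 b
    · have := hM.2 b r 1 le_rfl _ (h1 a)
      rw [polOp_one_cub r b hT, kron_self, kron_of_ne ha, cub_comm_left hT b a r] at this
      rw [show cub a b r T = (2⁻¹ : ℝ) •
        ((0 : ℝ) • cub b r r T + (1 : ℝ) • cub a b r T + (1 : ℝ) • cub a b r T) by module]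
      exact M.smul_mem _ this
  by_cases ha : a = r
  · rw [ha, cub_comm_left hT, cub_comm_right hT]
    exact h2 b c
  by_cases hb : b = r
  · rw [hb, cub_comm_right hT]
    exact h2 a c
  · have := hM.2 c r 1 le_rfl _ (h2 a b)
    rw [polOp_one_cub r c hT, kron_self, kron_of_ne ha, kron_of_ne hb, zero_smul, zero_add,
      zero_smul, zero_add, one_smul, cub_comm_left hT, cub_comm_right hT] at this
    exact this

end Closure

/-! ### An explicit spanning set closed under the operators -/

section Generators

variable {ι₁ ι₂ : Type*}

/-- Labels for the generators of a polarization module of a cubic. -/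
inductive Gen (ι₁ ι₂ : Type*) (ℓ : ℕ) : Type _
  | const : Gen ι₁ ι₂ ℓ
  | lin (i : ι₁) (a : Fin ℓ) : Gen ι₁ ι₂ ℓ
  | quad (i : ι₂) (a b : Fin ℓ) : Gen ι₁ ι₂ ℓ
  | cub (a b c : Fin ℓ) : Gen ι₁ ι₂ ℓ

/-- The vector degree of a generator. -/
def Gen.deg : Gen ι₁ ι₂ ℓ → Fin ℓ →₀ ℕ
  | .const => 0
  | .lin _ a => Finsupp.single a 1
  | .quad _ a b => Finsupp.single a 1 + Finsupp.single b 1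
  | .cub a b c => Finsupp.single a 1 + (Finsupp.single b 1 + Finsupp.single c 1)

variable (v₁ : ι₁ → Fin n → ℝ) (v₂ : ι₂ → Fin n → Fin n → ℝ) (T : Fin n → Fin n → Fin n → ℝ)

/-- The polynomial with a given label. -/
def Gen.poly : Gen ι₁ ι₂ ℓ → MatPoly ℓ n
  | .const => 1
  | .lin i a => Polarization.lin a (v₁ i)
  | .quad i a b => Polarization.quad a b (v₂ i)
  | .cub a b c => Polarization.cub a b c T

lemma Gen.isWeightedHomogeneous (g : Gen ι₁ ι₂ ℓ) :
    IsWeightedHomogeneous (rowWeight ℓ n) (g.poly v₁ v₂ T) g.deg := by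
  cases g with
  | const => exact isWeightedHomogeneous_one ℝ _
  | lin i a => exact isWeightedHomogeneous_lin a _
  | quad i a b => exact isWeightedHomogeneous_quad a b _
  | cub a b c => exact isWeightedHomogeneous_cub a b c _

/-- The span of all generators. -/
def genSpan (ℓ : ℕ) : Submodule ℝ (MatPoly ℓ n) :=
  Submodule.span ℝ (Set.range (Gen.poly v₁ v₂ T : Gen ι₁ ι₂ ℓ → MatPoly ℓ n))

variable {v₁ v₂ T}

lemma poly_mem_genSpan (g : Gen ι₁ ι₂ ℓ) : g.poly v₁ v₂ T ∈ genSpan v₁ v₂ T ℓ :=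
  Submodule.subset_span ⟨g, rfl⟩

lemma C_mem_genSpan (s : ℝ) : C s ∈ genSpan v₁ v₂ T ℓ := by
  have := (genSpan v₁ v₂ T ℓ).smul_mem s (poly_mem_genSpan .const)
  rwa [Gen.poly, smul_eq_C_mul, mul_one] at this

lemma lin_mem_genSpan {L : Fin n → ℝ} (hL : L ∈ Submodule.span ℝ (Set.range v₁)) (a : Fin ℓ) :
    lin a L ∈ genSpan v₁ v₂ T ℓ := by
  have := Submodule.mem_map_of_mem (f := lin a) hL
  rw [Submodule.map_span] at this
  refine Submodule.span_le.mpr ?_ this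
  rintro _ ⟨_, ⟨i, rfl⟩, rfl⟩
  exact poly_mem_genSpan (.lin i a)

lemma quad_mem_genSpan {Q : Fin n → Fin n → ℝ} (hQ : Q ∈ Submodule.span ℝ (Set.range v₂))
    (a b : Fin ℓ) : quad a b Q ∈ genSpan v₁ v₂ T ℓ := by
  have := Submodule.mem_map_of_mem (f := quad a b) hQ
  rw [Submodule.map_span] at this
  refine Submodule.span_le.mpr ?_ this
  rintro _ ⟨_, ⟨i, rfl⟩, rfl⟩
  exact poly_mem_genSpan (.quad i a b)

lemma cub_mem_genSpan (a b c : Fin ℓ) : cub a b c T ∈ genSpan v₁ v₂ T ℓ :=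
  poly_mem_genSpan (.cub a b c)

/-- The hypotheses place every slice and contraction of the coefficients back in the given spans,
and higher powers of the derivatives vanish for degree reasons. -/
lemma isClosedUnder_genSpan (hT : IsSymm₃ T) (h₂ : ∀ i, IsSymm₂ (v₂ i))
    (slice : ∀ j, T j ∈ Submodule.span ℝ (Set.range v₂))
    (contract : (fun j => T j j) ∈ Submodule.span ℝ (Set.range v₂))
    (row : ∀ i j, v₂ i j ∈ Submodule.span ℝ (Set.range v₁))
    (diag : ∀ i, (fun j => v₂ i j j) ∈ Submodule.span ℝ (Set.range v₁)) :
    IsClosedUnder (genSpan v₁ v₂ T ℓ) := by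
  -- The vector produced by `E^{(3)}` is the diagonal of the contraction, so it needs no separate
  -- hypothesis.
  have hdiag : (fun j => T j j j) ∈ Submodule.span ℝ (Set.range v₁) := by
    let D : (Fin n → Fin n → ℝ) →ₗ[ℝ] Fin n → ℝ :=
      LinearMap.pi fun j => LinearMap.proj j ∘ₗ LinearMap.proj j
    have := Submodule.mem_map_of_mem (f := D) contract
    rw [Submodule.map_span] at this
    refine Submodule.span_le.mpr ?_ this
    rintro _ ⟨_, ⟨i, rfl⟩, rfl⟩
    exact diag i
  set N := genSpan v₁ v₂ T ℓ with hN
  have ext : ∀ A : MatPoly ℓ n →ₗ[ℝ] MatPoly ℓ n,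
      (∀ g : Gen ι₁ ι₂ ℓ, A (g.poly v₁ v₂ T) ∈ N) → ∀ g ∈ N, A g ∈ N := by
    intro A hA
    change N ≤ N.comap A
    rw [hN, genSpan, Submodule.span_le]
    rintro _ ⟨g, rfl⟩
    exact hA g
  refine ⟨fun r j => ext _ fun g => ?_, fun i r p hp => ext _ fun g => ?_⟩
  · cases g with
    | const =>
      rw [Gen.poly, ← C_1, partialD_C]
      exact N.zero_mem
    | lin i a =>
      rw [Gen.poly, partialD_lin]
      exact N.smul_mem _ (C_mem_genSpan _)
    | quad i a b =>
      rw [Gen.poly, partialD_quad r j (h₂ i)]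
      exact N.add_mem (N.smul_mem _ (lin_mem_genSpan (row i j) _))
        (N.smul_mem _ (lin_mem_genSpan (row i j) _))
    | cub a b c =>
      rw [Gen.poly, partialD_cub r j hT]
      exact N.add_mem (N.add_mem (N.smul_mem _ (quad_mem_genSpan (slice j) _ _))
        (N.smul_mem _ (quad_mem_genSpan (slice j) _ _)))
        (N.smul_mem _ (quad_mem_genSpan (slice j) _ _))
  · obtain ⟨p, rfl⟩ := Nat.exists_eq_add_of_le' hp
    cases g with
    | const =>
      rw [Gen.poly, ← C_1, polOp_C]
      exact N.zero_mem
    | lin i' a =>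
      rw [Gen.poly]
      match p with
      | 0 =>
        rw [zero_add, polOp_one_lin]
        exact N.smul_mem _ (poly_mem_genSpan (.lin i' i))
      | p + 1 =>
        rw [polOp_add_two_lin]
        exact N.zero_mem
    | quad i' a b =>
      rw [Gen.poly]
      match p with
      | 0 =>
        rw [zero_add, polOp_one_quad r i (h₂ i')]
        exact N.add_mem (N.smul_mem _ (poly_mem_genSpan (.quad i' _ _)))
          (N.smul_mem _ (poly_mem_genSpan (.quad i' _ _)))
      | 1 =>
        rw [polOp_two_quad r i (h₂ i')]
        exact N.smul_mem _ (lin_mem_genSpan (diag i') _)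
      | p + 2 =>
        rw [polOp_add_three_quad r i p (h₂ i')]
        exact N.zero_mem
    | cub a b c =>
      rw [Gen.poly]
      match p with
      | 0 =>
        rw [zero_add, polOp_one_cub r i hT]
        exact N.add_mem (N.add_mem (N.smul_mem _ (cub_mem_genSpan _ _ _))
          (N.smul_mem _ (cub_mem_genSpan _ _ _))) (N.smul_mem _ (cub_mem_genSpan _ _ _))
      | 1 =>
        rw [polOp_two_cub r i hT]
        exact N.add_mem (N.add_mem (N.smul_mem _ (quad_mem_genSpan contract _ _))
          (N.smul_mem _ (quad_mem_genSpan contract _ _)))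
          (N.smul_mem _ (quad_mem_genSpan contract _ _))
      | 2 =>
        rw [polOp_three_cub r i hT]
        exact N.smul_mem _ (lin_mem_genSpan hdiag _)
      | p + 3 =>
        rw [polOp_add_four_cub r i p hT]
        exact N.zero_mem

lemma single_add_single_inj {a b i k : Fin ℓ}
    (h : (Finsupp.single a 1 + Finsupp.single b 1 : Fin ℓ →₀ ℕ) =
      Finsupp.single i 1 + Finsupp.single k 1) : a = i ∧ b = k ∨ a = k ∧ b = i := by
  have key : ∀ {c d : Fin ℓ}, (Finsupp.single c 1 : Fin ℓ →₀ ℕ) = Finsupp.single d 1 → c = d :=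
    fun h => Finsupp.single_left_injective one_ne_zero h
  by_cases hai : a = i
  · subst hai
    exact .inl ⟨rfl, key (add_left_cancel h)⟩
  · have hak : a = k := by
      by_contra hak
      have := DFunLike.congr_fun h a
      simp only [Finsupp.add_apply, Finsupp.single_apply, if_neg (Ne.symm hai),
        if_neg (Ne.symm hak), if_true] at this
      omega
    subst hak
    rw [add_comm (Finsupp.single i 1)] at h
    exact .inr ⟨rfl, key (add_left_cancel h)⟩

lemma quad_eq_of_deg_eq {Q : Fin n → Fin n → ℝ} (hQ : IsSymm₂ Q) {a b i k : Fin ℓ}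
    (h : (Finsupp.single a 1 + Finsupp.single b 1 : Fin ℓ →₀ ℕ) =
      Finsupp.single i 1 + Finsupp.single k 1) : quad a b Q = quad i k Q := by
  rcases single_add_single_inj h with ⟨rfl, rfl⟩ | ⟨rfl, rfl⟩
  · rfl
  · exact quad_comm hQ _ _

lemma cub_eq_of_deg_eq {T : Fin n → Fin n → Fin n → ℝ} (hT : IsSymm₃ T) {a b c i k m : Fin ℓ}
    (h : (Finsupp.single a 1 + (Finsupp.single b 1 + Finsupp.single c 1) : Fin ℓ →₀ ℕ) =
      Finsupp.single i 1 + (Finsupp.single k 1 + Finsupp.single m 1)) :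
    cub a b c T = cub i k m T := by
  have key : ∀ {k m : Fin ℓ}, (Finsupp.single b 1 + Finsupp.single c 1 : Fin ℓ →₀ ℕ) =
      Finsupp.single k 1 + Finsupp.single m 1 → cub a b c T = cub a k m T := by
    intro k m h
    rcases single_add_single_inj h with ⟨rfl, rfl⟩ | ⟨rfl, rfl⟩
    · rfl
    · exact cub_comm_right hT _ _ _
  by_cases hai : a = i
  · subst hai
    exact key (add_left_cancel h)
  by_cases hak : a = k
  · subst hak
    rw [add_left_comm (Finsupp.single i 1)] at h
    rw [key (add_left_cancel h), cub_comm_left hT]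
  have ham : a = m := by
    by_contra ham
    have := DFunLike.congr_fun h a
    simp only [Finsupp.add_apply, Finsupp.single_apply, if_neg (Ne.symm hai),
      if_neg (Ne.symm hak), if_neg (Ne.symm ham), if_true] at this
    omega
  subst ham
  rw [add_comm (Finsupp.single k 1), add_left_comm (Finsupp.single i 1)] at h
  rw [key (add_left_cancel h), cub_comm_left hT, cub_comm_right hT]

end Generators

/-! ### The polarization module and its graded Frobenius characteristic -/

section Structure

variable [NeZero ℓ] {ι₁ ι₂ : Type*}

/-- Linearly independent families of linear and quadratic forms, permuted by the symmetric group,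
whose polarizations span the parts of degree one and two of the polarization module of the cubic
with coefficients `T`. -/
structure IsPolarizationBasis (ℓ : ℕ) [NeZero ℓ] (T : Fin n → Fin n → Fin n → ℝ)
    (v₁ : ι₁ → Fin n → ℝ) (v₂ : ι₂ → Fin n → Fin n → ℝ) (act₁ : Perm (Fin n) → ι₁ → ι₁)
    (act₂ : Perm (Fin n) → ι₂ → ι₂) : Prop where
  symm₃ : IsSymm₃ T
  symm₂ : ∀ i, IsSymm₂ (v₂ i)
  perm₃ : ∀ (σ : Perm (Fin n)) j k m, T (σ j) (σ k) (σ m) = T j k m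
  perm₂ : ∀ (σ : Perm (Fin n)) i j k, v₂ (act₂ σ i) (σ j) (σ k) = v₂ i j k
  perm₁ : ∀ (σ : Perm (Fin n)) i j, v₁ (act₁ σ i) (σ j) = v₁ i j
  linearIndependent₂ : LinearIndependent ℝ v₂
  linearIndependent₁ : LinearIndependent ℝ v₁
  slice : ∀ j, T j ∈ Submodule.span ℝ (Set.range v₂)
  contract : (fun j => T j j) ∈ Submodule.span ℝ (Set.range v₂)
  row : ∀ i j, v₂ i j ∈ Submodule.span ℝ (Set.range v₁)
  diag : ∀ i, (fun j => v₂ i j j) ∈ Submodule.span ℝ (Set.range v₁)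
  quad_mem : ∀ i, quad 0 0 (v₂ i) ∈ (polModule (cub (0 : Fin ℓ) 0 0 T)).toSubmodule
  lin_mem : ∀ i, lin 0 (v₁ i) ∈ (polModule (cub (0 : Fin ℓ) 0 0 T)).toSubmodule

variable {T : Fin n → Fin n → Fin n → ℝ}

omit [NeZero ℓ] in
lemma isClosedUnder_polModule (f : MatPoly ℓ n) : IsClosedUnder (polModule f).toSubmodule :=
  isClosedUnder_polClosure _

omit [NeZero ℓ] in
lemma self_mem_polModule (f : MatPoly ℓ n) : f ∈ (polModule f).toSubmodule :=
  subset_polClosure _ ⟨1, congrArg (fun A => A f) (map_one (diagAction ℓ n))⟩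

/-- Differentiating three times along a nonzero coefficient gives the nonzero constant `6 * T j k
m`. -/
lemma one_mem_polModule_cub (hT : IsSymm₃ T) (h0 : cub (0 : Fin ℓ) 0 0 T ≠ 0) :
    1 ∈ (polModule (cub (0 : Fin ℓ) 0 0 T)).toSubmodule := by
  set M := (polModule (cub (0 : Fin ℓ) 0 0 T)).toSubmodule
  have hM : IsClosedUnder M := isClosedUnder_polModule _
  have hne : ∃ j k m, T j k m ≠ 0 := by
    by_contra! h
    refine h0 ?_
    rw [show T = 0 from funext₃ h, map_zero]
  obtain ⟨j, k, m, hjkm⟩ := hne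
  have := hM.1 0 m _ (hM.1 0 k _ (hM.1 0 j _ (self_mem_polModule (cub (0 : Fin ℓ) 0 0 T))))
  simp only [partialD_cub _ _ hT, partialD_quad _ _ (hT.isSymm₂ _), partialD_lin, map_add,
    kron_self, one_smul] at this
  rw [show (1 : MatPoly ℓ n) = (6 * T j k m)⁻¹ • (C (T j k m) + C (T j k m) +
    (C (T j k m) + C (T j k m)) + (C (T j k m) + C (T j k m))) by
      simp only [← map_add, ← C_mul', ← map_mul]
      rw [← C_1]
      congr 1
      field_simp
      ring]
  exact M.smul_mem _ this

variable {v₁ : ι₁ → Fin n → ℝ} {v₂ : ι₂ → Fin n → Fin n → ℝ} {act₁ : Perm (Fin n) → ι₁ → ι₁}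
  {act₂ : Perm (Fin n) → ι₂ → ι₂}

lemma IsPolarizationBasis.polModule_eq (h : IsPolarizationBasis ℓ T v₁ v₂ act₁ act₂)
    (h0 : cub (0 : Fin ℓ) 0 0 T ≠ 0) :
    (polModule (cub (0 : Fin ℓ) 0 0 T)).toSubmodule = genSpan v₁ v₂ T ℓ := by
  have hM := isClosedUnder_polModule (cub (0 : Fin ℓ) 0 0 T)
  apply le_antisymm
  · refine polClosure_le ?_
      (isClosedUnder_genSpan h.symm₃ h.symm₂ h.slice h.contract h.row h.diag)
    rintro _ ⟨σ, rfl⟩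
    have := diagAction_cub σ (0 : Fin ℓ) 0 0 T
    simp only [h.perm₃] at this
    change diagAction ℓ n σ (cub 0 0 0 T) ∈ _
    rw [this]
    exact cub_mem_genSpan 0 0 0
  · rw [genSpan, Submodule.span_le]
    rintro _ ⟨g, rfl⟩
    cases g with
    | const => exact one_mem_polModule_cub h.symm₃ h0
    | lin i a => exact hM.lin_mem (h.lin_mem i) a
    | quad i a b => exact hM.quad_mem (h.symm₂ i) (h.quad_mem i) a b
    | cub a b c => exact hM.cub_mem h.symm₃ (self_mem_polModule _) a b c

omit [NeZero ℓ] in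
lemma exists_single_of_degree_eq_succ {d : Fin ℓ →₀ ℕ} {k : ℕ} (h : d.degree = k + 1) :
    ∃ i e, d = Finsupp.single i 1 + e ∧ e.degree = k := by
  have hd : d ≠ 0 := by
    rintro rfl
    simp at h
  obtain ⟨i, hi⟩ := Finsupp.support_nonempty_iff.mpr hd
  have hle : Finsupp.single i 1 ≤ d :=
    Finsupp.single_le_iff.mpr (Nat.one_le_iff_ne_zero.mpr (Finsupp.mem_support_iff.mp hi))
  have hadd := add_tsub_cancel_of_le hle
  refine ⟨i, _, hadd.symm, ?_⟩
  have := congrArg Finsupp.degree hadd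
  rw [map_add, Finsupp.degree_single, h] at this
  omega

omit [NeZero ℓ] in
lemma Gen.degree_deg (g : Gen ι₁ ι₂ ℓ) : g.deg.degree = match g with
    | .const => 0
    | .lin _ _ => 1
    | .quad _ _ _ => 2
    | .cub _ _ _ => 3 := by
  cases g <;> simp [Gen.deg, Finsupp.degree_single]

/-- Generators with the same vector degree and index differ only in the order of their rows, hence
coincide by symmetry. Each graded piece thus has one of the families `v₁`, `v₂`, or a single
invariant form, as permuted basis. -/
theorem IsPolarizationBasis.frobChar_eq [Fintype ι₁] [DecidableEq ι₁] [Fintype ι₂] [DecidableEq ι₂]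
    (h : IsPolarizationBasis ℓ T v₁ v₂ act₁ act₂) (h0 : cub (0 : Fin ℓ) 0 0 T ≠ 0) :
    frobChar (polModule (cub (0 : Fin ℓ) 0 0 T)) = (1 + hq ℓ 3) * hw ℓ [n] +
      hq ℓ 1 * MvPowerSeries.C (permFrob n act₁) + hq ℓ 2 * MvPowerSeries.C (permFrob n act₂) := by
  ext1 d
  have hspan : (polModule (cub (0 : Fin ℓ) 0 0 T) ⊓ degreePart ℓ n d).toSubmodule =
      Submodule.span ℝ (Gen.poly v₁ v₂ T '' {g | g.deg = d}) := by
    rw [Subrepresentation.toSubmodule_inf, h.polModule_eq h0, genSpan]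
    exact span_inf_degreePart _ _ (Gen.isWeightedHomogeneous v₁ v₂ T) d
  have hrhs : MvPowerSeries.coeff d ((1 + hq ℓ 3) * hw ℓ [n] +
      hq ℓ 1 * MvPowerSeries.C (permFrob n act₁) + hq ℓ 2 * MvPowerSeries.C (permFrob n act₂)) =
      if d.degree = 0 ∨ d.degree = 3 then hSymPart ℕ ℝ [n] else if d.degree = 1 then permFrob n act₁
      else if d.degree = 2 then permFrob n act₂ else 0 := by
    -- Reading `1` as `h_0(q)` makes every summand an `h_k(q)`, whose coefficients depend only on
    -- total degree.
    rw [← hSym_zero (Fin ℓ)]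
    simp only [map_add, MvPowerSeries.coeff_mul_C, coeff_hSym]
    split_ifs <;> first | omega | simp
  rw [hrhs]
  rcases hk : d.degree with _ | _ | _ | _ | k
  · rw [if_pos (by simp), ← permFrob_unit]
    obtain rfl := (Finsupp.degree_eq_zero_iff d).mp hk
    refine coeff_frobChar_eq_permFrob _ 0 (v := fun _ : Unit => (1 : MatPoly ℓ n)) ?_ ?_ ?_
    · exact LinearIndependent.of_subsingleton () one_ne_zero
    · rw [hspan]
      congr 1
      ext x
      constructor
      · rintro ⟨g, hg, rfl⟩
        have := congrArg Finsupp.degree hg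
        rw [g.degree_deg, map_zero] at this
        cases g <;> simp at this
        exact ⟨(), rfl⟩
      · rintro ⟨_, rfl⟩
        exact ⟨.const, rfl, rfl⟩
    · exact fun σ _ => diagAction_C σ 1
  · rw [if_neg (by simp), if_pos rfl]
    obtain ⟨i, e, rfl, he⟩ := exists_single_of_degree_eq_succ hk
    obtain rfl := (Finsupp.degree_eq_zero_iff e).mp he
    refine coeff_frobChar_eq_permFrob _ _ (v := fun k => lin i (v₁ k)) ?_ ?_ ?_
    · exact h.linearIndependent₁.map' (lin i)
        (LinearMap.ker_eq_bot'.mpr fun _ => eq_zero_of_lin_eq_zero)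
    · rw [hspan]
      congr 1
      ext x
      constructor
      · rintro ⟨g, hg, rfl⟩
        have := congrArg Finsupp.degree hg
        rw [g.degree_deg, hk] at this
        cases g <;> simp at this
        rename_i k a
        rw [Set.mem_ofPred_eq, Gen.deg, add_zero] at hg
        obtain rfl := Finsupp.single_left_injective one_ne_zero hg
        exact ⟨k, rfl⟩
      · rintro ⟨k, rfl⟩
        exact ⟨.lin k i, (add_zero _).symm, rfl⟩
    · intro σ k
      rw [← diagAction_lin σ i (v₁ (act₁ σ k))]
      congr 2
      exact funext fun j => (h.perm₁ σ k j).symm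
  · rw [if_neg (by simp), if_neg (by simp), if_pos rfl]
    obtain ⟨i, e, rfl, he⟩ := exists_single_of_degree_eq_succ hk
    obtain ⟨k, e, rfl, he'⟩ := exists_single_of_degree_eq_succ he
    obtain rfl := (Finsupp.degree_eq_zero_iff e).mp he'
    refine coeff_frobChar_eq_permFrob _ _ (v := fun m => quad i k (v₂ m)) ?_ ?_ ?_
    · rw [Fintype.linearIndependent_iff]
      intro g hg
      refine Fintype.linearIndependent_iff.mp h.linearIndependent₂ g ?_
      refine eq_zero_of_quad_eq_zero (a := i) (b := k) ?_ ?_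
      · intro j m
        simp only [Finset.sum_apply, Pi.smul_apply, h.symm₂ _ j m]
      · rw [map_sum, ← hg]
        simp only [map_smul]
    · rw [hspan]
      congr 1
      ext x
      constructor
      · rintro ⟨g, hg, rfl⟩
        have := congrArg Finsupp.degree hg
        rw [g.degree_deg, hk] at this
        cases g <;> simp at this
        rename_i m a b
        rw [Set.mem_ofPred_eq, Gen.deg, add_zero] at hg
        exact ⟨m, (quad_eq_of_deg_eq (h.symm₂ m) hg).symm⟩
      · rintro ⟨m, rfl⟩
        exact ⟨.quad m i k, by simp [Gen.deg], rfl⟩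
    · intro σ m
      rw [← diagAction_quad σ i k (v₂ (act₂ σ m))]
      congr 2
      exact funext₂ fun j j' => (h.perm₂ σ m j j').symm
  · rw [if_pos (by simp), ← permFrob_unit]
    obtain ⟨i, e, rfl, he⟩ := exists_single_of_degree_eq_succ hk
    obtain ⟨k, e, rfl, he'⟩ := exists_single_of_degree_eq_succ he
    obtain ⟨m, e, rfl, he''⟩ := exists_single_of_degree_eq_succ he'
    obtain rfl := (Finsupp.degree_eq_zero_iff e).mp he''
    refine coeff_frobChar_eq_permFrob _ _ (v := fun _ : Unit => cub i k m T) ?_ ?_ ?_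
    · exact LinearIndependent.of_subsingleton () (cub_ne_zero_of_cub_ne_zero 0 h0)
    · rw [hspan]
      congr 1
      ext x
      constructor
      · rintro ⟨g, hg, rfl⟩
        have := congrArg Finsupp.degree hg
        rw [g.degree_deg, hk] at this
        cases g <;> simp at this
        rw [Set.mem_ofPred_eq, Gen.deg, add_zero] at hg
        exact ⟨(), (cub_eq_of_deg_eq h.symm₃ hg).symm⟩
      · rintro ⟨_, rfl⟩
        exact ⟨.cub i k m, by simp [Gen.deg], rfl⟩
    · intro σ _
      have := diagAction_cub σ i k m T
      simpa only [h.perm₃] using this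
  · rw [if_neg (by omega), if_neg (by omega), if_neg (by omega)]
    -- Above degree three there are no generators, so the empty family is a basis.
    rw [coeff_frobChar_eq_permFrob (ι := Empty) (v := Empty.elim) (act := fun _ => id) _ d
      (linearIndependent_empty_type)]
    · simp [permFrob]
    · rw [hspan]
      congr 1
      ext x
      constructor
      · rintro ⟨g, hg, rfl⟩
        have := congrArg Finsupp.degree hg
        rw [g.degree_deg, hk] at this
        cases g <;> simp at this
      · rintro ⟨⟨⟩, _⟩
    · rintro _ ⟨⟩

end Structure

end Polarization
end

noncomputable section
namespace Polarization

open Equiv Finset MvPolynomial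

variable {ℓ n : ℕ}

/-! ### From monomial symmetric functions to symmetric tensors -/

section CubicCoefficients

/-- The coefficients of the symmetric trilinear form of `a m_3 + b m_{21} + c m_{111}`. -/
def cubicTensor (n : ℕ) (a b c : ℝ) (j k m : Fin n) : ℝ :=
  if j = k ∧ k = m then a else if j = k ∨ k = m ∨ j = m then b / 3 else c / 6

/-- The symmetric power element given by a triple. -/
def tripleSym {α : Type*} (x : α × α × α) : Sym α 3 := ⟨{x.1, x.2.1, x.2.2}, rfl⟩

variable {α : Type*}

lemma tripleSym_surjective : Function.Surjective (tripleSym : α × α × α → Sym α 3) := by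
  rintro ⟨s, hs⟩
  obtain ⟨x, y, z, rfl⟩ := Multiset.card_eq_three.mp hs
  exact ⟨(x, y, z), rfl⟩

lemma multiset_pair_eq_pair {y z k m : α} (h : ({y, z} : Multiset α) = {k, m}) :
    y = k ∧ z = m ∨ y = m ∧ z = k := by
  have hy : y ∈ ({k, m} : Multiset α) := h ▸ Multiset.mem_cons_self y {z}
  rcases Multiset.mem_cons.mp hy with rfl | hy
  · exact .inl ⟨rfl, Multiset.singleton_inj.mp ((Multiset.cons_inj_right y).mp h)⟩
  · obtain rfl := Multiset.mem_singleton.mp hy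
    rw [Multiset.pair_comm k] at h
    exact .inr ⟨rfl, Multiset.singleton_inj.mp ((Multiset.cons_inj_right y).mp h)⟩

lemma tripleSym_eq_iff (x y z j k m : α) : tripleSym (x, y, z) = tripleSym (j, k, m) ↔
    (x = j ∧ y = k ∧ z = m) ∨ (x = j ∧ y = m ∧ z = k) ∨ (x = k ∧ y = j ∧ z = m) ∨
    (x = k ∧ y = m ∧ z = j) ∨ (x = m ∧ y = j ∧ z = k) ∨ (x = m ∧ y = k ∧ z = j) := by
  classical
  constructor
  · intro h
    have h' : (x ::ₘ {y, z} : Multiset α) = j ::ₘ k ::ₘ {m} := congrArg Subtype.val h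
    have hx : x ∈ (j ::ₘ k ::ₘ {m} : Multiset α) := h' ▸ Multiset.mem_cons_self x {y, z}
    rw [Multiset.mem_cons, Multiset.mem_cons, Multiset.mem_singleton] at hx
    rcases hx with rfl | rfl | rfl
    · rcases multiset_pair_eq_pair ((Multiset.cons_inj_right x).mp h') with h | h <;> tauto
    · rw [Multiset.cons_swap] at h'
      rcases multiset_pair_eq_pair ((Multiset.cons_inj_right x).mp h') with h | h <;> tauto
    · have h3 : (j ::ₘ k ::ₘ {x} : Multiset α) = x ::ₘ {j, k} := by
        rw [show (k ::ₘ {x} : Multiset α) = x ::ₘ {k} from Multiset.pair_comm k x,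
          Multiset.cons_swap]
        rfl
      rw [h3] at h'
      rcases multiset_pair_eq_pair ((Multiset.cons_inj_right x).mp h') with h | h <;> tauto
  · rintro (⟨rfl, rfl, rfl⟩ | ⟨rfl, rfl, rfl⟩ | ⟨rfl, rfl, rfl⟩ | ⟨rfl, rfl, rfl⟩ |
      ⟨rfl, rfl, rfl⟩ | ⟨rfl, rfl, rfl⟩)
    · rfl
    all_goals
      refine Subtype.ext (Multiset.coe_eq_coe.mpr ?_)
      simp only [List.perm_iff_count, List.count_cons, List.count_nil]
      intro a
      ring

variable [DecidableEq α]

lemma ofSym_tripleSym_same (j : α) :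
    Nat.Partition.ofSym (tripleSym (j, j, j)) = .ofSums 3 {3} rfl := by
  ext1
  simp [Nat.Partition.ofSym, tripleSym]
  rfl

lemma ofSym_tripleSym_pair {j k : α} (h : j ≠ k) :
    Nat.Partition.ofSym (tripleSym (j, j, k)) = .ofSums 3 {2, 1} rfl := by
  ext1
  simp [Nat.Partition.ofSym, tripleSym, h, h.symm, Multiset.filter_cons_of_pos]
  rfl

lemma ofSym_tripleSym_distinct {j k m : α} (hjk : j ≠ k) (hkm : k ≠ m) (hjm : j ≠ m) :
    Nat.Partition.ofSym (tripleSym (j, k, m)) = .ofSums 3 {1, 1, 1} rfl := by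
  ext1
  simp [Nat.Partition.ofSym, tripleSym, hjk, hkm, hjm, hjk.symm, hkm.symm, hjm.symm]
  rfl

/-- A monomial `x³`, `x²y` or `xyz` comes from 1, 3 or 6 ordered triples of indices, which accounts
for the denominators in `cubicTensor`. -/
lemma sum_cubicTensor_fiber (a b c : ℝ) (s : Sym (Fin n) 3) :
    ∑ x : Fin n × Fin n × Fin n with tripleSym x = s, cubicTensor n a b c x.1 x.2.1 x.2.2 =
      (if Nat.Partition.ofSym s = .ofSums 3 {3} rfl then a else 0) +
      (if Nat.Partition.ofSym s = .ofSums 3 {2, 1} rfl then b else 0) +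
      (if Nat.Partition.ofSym s = .ofSums 3 {1, 1, 1} rfl then c else 0) := by
  have hpair : ∀ j k : Fin n, j ≠ k → s = tripleSym (j, j, k) →
      ∑ x : Fin n × Fin n × Fin n with tripleSym x = s, cubicTensor n a b c x.1 x.2.1 x.2.2 =
      (if Nat.Partition.ofSym s = .ofSums 3 {3} rfl then a else 0) +
      (if Nat.Partition.ofSym s = .ofSums 3 {2, 1} rfl then b else 0) +
      (if Nat.Partition.ofSym s = .ofSums 3 {1, 1, 1} rfl then c else 0) := by
    rintro j k h rfl
    have hset : ({x | tripleSym x = tripleSym (j, j, k)} : Finset (Fin n × Fin n × Fin n)) =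
        {(j, j, k), (j, k, j), (k, j, j)} := by
      ext ⟨x, y, z⟩
      rw [Finset.mem_filter_univ, tripleSym_eq_iff]
      simp only [Finset.mem_insert, Finset.mem_singleton, Prod.mk.injEq]
      tauto
    rw [hset, Finset.sum_insert (by simp [h, h.symm]), Finset.sum_insert (by simp [h, h.symm]),
      Finset.sum_singleton, ofSym_tripleSym_pair h, if_neg (by decide), if_pos rfl,
      if_neg (by decide)]
    simp only [cubicTensor, h, h.symm, and_true, and_false, if_false, true_or, or_true,
      if_true]
    ring
  obtain ⟨⟨j, k, m⟩, rfl⟩ := tripleSym_surjective s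
  by_cases hjk : j = k
  · by_cases hkm : k = m
    · subst hjk hkm
      have hset : ({x | tripleSym x = tripleSym (j, j, j)} : Finset (Fin n × Fin n × Fin n)) =
          {(j, j, j)} := by
        ext ⟨x, y, z⟩
        rw [Finset.mem_filter_univ, tripleSym_eq_iff]
        simp only [Finset.mem_singleton, Prod.mk.injEq]
        tauto
      rw [hset, Finset.sum_singleton, ofSym_tripleSym_same, if_pos rfl, if_neg (by decide),
        if_neg (by decide)]
      simp [cubicTensor]
    · subst hjk
      exact hpair j m hkm rfl
  · by_cases hkm : k = m
    · subst hkm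
      refine hpair k j (Ne.symm hjk) ((tripleSym_eq_iff ..).mpr ?_)
      tauto
    by_cases hjm : j = m
    · subst hjm
      refine hpair j k hjk ((tripleSym_eq_iff ..).mpr ?_)
      tauto
    have hset : ({x | tripleSym x = tripleSym (j, k, m)} : Finset (Fin n × Fin n × Fin n)) =
        {(j, k, m), (j, m, k), (k, j, m), (k, m, j), (m, j, k), (m, k, j)} := by
      ext ⟨x, y, z⟩
      rw [Finset.mem_filter_univ, tripleSym_eq_iff]
      simp only [Finset.mem_insert, Finset.mem_singleton, Prod.mk.injEq]
    have hkj := Ne.symm hjk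
    have hmk := Ne.symm hkm
    have hmj := Ne.symm hjm
    rw [hset, Finset.sum_insert (by simp [*]), Finset.sum_insert (by simp [*]),
      Finset.sum_insert (by simp [*]), Finset.sum_insert (by simp [*]),
      Finset.sum_insert (by simp [*]), Finset.sum_singleton, ofSym_tripleSym_distinct hjk hkm hjm,
      if_neg (by decide), if_neg (by decide), if_pos rfl]
    simp only [cubicTensor, hjk, hkm, hjm, hkj, hmk, hmj, and_self, or_self, if_false]
    ring

lemma cubic_eq_cub [NeZero ℓ] (a b c : ℝ) :
    cubic ℓ n a b c = cub 0 0 0 (cubicTensor n a b c) := by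
  have hm : ∀ μ : Nat.Partition 3, msymm (Fin n) ℝ μ =
      ∑ s : Sym (Fin n) 3, if Nat.Partition.ofSym s = μ then (s.1.map X).prod else 0 := by
    intro μ
    rw [← Finset.sum_filter, msymm]
    refine (Finset.sum_subtype (univ.filter fun s : Sym (Fin n) 3 => Nat.Partition.ofSym s = μ)
      (fun s => ?_) fun s => (s.1.map X).prod).symm
    exact Finset.mem_filter_univ s
  have hterm : ∀ s : Sym (Fin n) 3, ∀ t : ℝ, ∀ μ : Nat.Partition 3,
      (t • if Nat.Partition.ofSym s = μ then (s.1.map X).prod else (0 : MvPolynomial (Fin n) ℝ)) =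
      (if Nat.Partition.ofSym s = μ then t else 0) • (s.1.map X).prod := by
    intro s t μ
    split_ifs <;> simp
  have hsum : a • msymm (Fin n) ℝ (.ofSums 3 {3} rfl) + b • msymm (Fin n) ℝ (.ofSums 3 {2, 1} rfl) +
      c • msymm (Fin n) ℝ (.ofSums 3 {1, 1, 1} rfl) =
      ∑ x : Fin n × Fin n × Fin n,
        cubicTensor n a b c x.1 x.2.1 x.2.2 • (X x.1 * (X x.2.1 * X x.2.2)) := by
    rw [← Finset.sum_fiberwise univ tripleSym]
    simp only [hm, Finset.smul_sum, hterm, ← Finset.sum_add_distrib, ← add_smul]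
    refine Finset.sum_congr rfl fun s _ => ?_
    rw [← sum_cubicTensor_fiber, Finset.sum_smul]
    refine Finset.sum_congr rfl fun x hx => ?_
    rw [← (Finset.mem_filter.mp hx).2]
    simp [tripleSym]
  rw [cubic, hsum, map_sum, Fintype.sum_prod_type]
  simp only [Fintype.sum_prod_type, cub_apply, quad_apply, lin_apply, Finset.mul_sum, map_mul,
    rename_X, rename_C, smul_eq_C_mul]
  refine Finset.sum_congr rfl fun j _ => Finset.sum_congr rfl fun k _ =>
    Finset.sum_congr rfl fun m _ => ?_
  ring

end CubicCoefficients

end Polarization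
end

noncomputable section
namespace Polarization

open Equiv Finset MvPolynomial

variable {ℓ n : ℕ}

/-! ### When the tensor is constant or zero -/

section TensorProperties

variable (n) (a b c : ℝ)

lemma cubicTensor_isSymm₃ : IsSymm₃ (cubicTensor n a b c) := by
  constructor <;> intro j k m <;> simp only [cubicTensor] <;> grind

lemma cubicTensor_perm (σ : Perm (Fin n)) (j k m : Fin n) :
    cubicTensor n a b c (σ j) (σ k) (σ m) = cubicTensor n a b c j k m := by
  simp only [cubicTensor, σ.injective.eq_iff]

lemma cubicTensor_self (j : Fin n) : cubicTensor n a b c j j j = a := by simp [cubicTensor]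

lemma cubicTensor_one_three_six : cubicTensor n 1 3 6 = fun _ _ _ => 1 := by
  funext j k m
  simp only [cubicTensor]
  split_ifs <;> norm_num

variable {n a b c}

/-- Comparing the `(i, i)` entries gives `a = b / 3`. If an entry with distinct indices exists, some
`m` differs from both `i` and `k`, and the `(i, m)` entries give `b / 3 = c / 6`. -/
lemma cubicTensor_eq_const {i k : Fin n} (hik : i ≠ k)
    (h : cubicTensor n a b c i = cubicTensor n a b c k) : cubicTensor n a b c = fun _ _ _ => a := by
  have h1 := congrFun (congrFun h i) i
  have h2 := congrFun h i
  simp only [cubicTensor, hik.symm] at h1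
  funext x y z
  simp only [cubicTensor]
  split_ifs with h3 h4
  · rfl
  · simpa using h1.symm
  · obtain ⟨m, hmi, hmk⟩ : ∃ m, m ≠ i ∧ m ≠ k := by
      by_contra! hm
      have hx := hm x
      have hy := hm y
      have hz := hm z
      grind
    have h5 := congrFun h2 m
    simp only [cubicTensor, hmi.symm, hmk.symm, hik.symm] at h5
    simp at h1 h5
    linarith

lemma cubicTensor_eq_zero (hn : 2 ≤ n) (ha : a = 0)
    (h : ∀ j k, ∑ m, cubicTensor n a b c j k m = 0) : cubicTensor n a b c = 0 := by
  subst ha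
  have hb : b = 0 := by
    let j : Fin n := ⟨0, by omega⟩
    let k : Fin n := ⟨1, by omega⟩
    have hjk : j ≠ k := by simp [j, k]
    -- After multiplication by `b` all terms are nonnegative, so each vanishes and none has to be
    -- counted. The same device with `c` below also covers `n = 2`, where `c` never occurs.
    have h1 : ∑ m, b * cubicTensor n 0 b c j j m = 0 := by rw [← Finset.mul_sum, h, mul_zero]
    have h2 := (Finset.sum_eq_zero_iff_of_nonneg fun m _ => ?_).mp h1 k (Finset.mem_univ _)
    · simp only [cubicTensor, hjk] at h2
      simp at h2
      exact h2
    · simp only [cubicTensor]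
      split_ifs with h3 h4
      · rw [mul_zero]
      · nlinarith [mul_self_nonneg b]
      · simp at h4
  subst hb
  funext j k m
  have h1 : ∑ m, c * cubicTensor n 0 0 c j k m = 0 := by rw [← Finset.mul_sum, h, mul_zero]
  have h2 := (Finset.sum_eq_zero_iff_of_nonneg fun m _ => ?_).mp h1 m (Finset.mem_univ _)
  · simp only [cubicTensor] at h2 ⊢
    split_ifs at h2 ⊢ <;> simp_all
  · simp only [cubicTensor]
    split_ifs <;> nlinarith [mul_self_nonneg c]

end TensorProperties

/-! ### Linear algebra of families and subspaces stable under permutations -/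

section PermutedFamilies

lemma exists_perm_apply_eq {α : Type*} [DecidableEq α] {i k p q : α} (hik : i ≠ k) (hpq : p ≠ q) :
    ∃ σ : Perm α, σ p = i ∧ σ q = k := by
  refine ⟨swap (swap p i q) k * swap p i, ?_, ?_⟩
  · rw [Perm.mul_apply, swap_apply_left]
    refine swap_apply_of_ne_of_ne ?_ hik
    intro h
    rw [eq_comm, swap_apply_eq_iff, swap_apply_right] at h
    exact hpq h.symm
  · rw [Perm.mul_apply, swap_apply_left]

/-- Subtracting from a linear relation its image under the transposition of `i` and `k` leaves `(c i
- c k) • (g i - g k) = 0`. So all coefficients agree, and the nonzero sum makes them vanish. -/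
lemma linearIndependent_of_perm {g : Fin n → Fin n → Fin n → ℝ}
    (hg : ∀ (σ : Perm (Fin n)) i j k, g (σ i) (σ j) (σ k) = g i j k)
    (hne : ∀ i k, i ≠ k → g i ≠ g k) (hsum : ∑ i, g i ≠ 0) : LinearIndependent ℝ g := by
  rw [Fintype.linearIndependent_iff]
  intro c hc
  have hperm : ∀ σ : Perm (Fin n), ∑ i, c i • g (σ i) = 0 := by
    intro σ
    funext j k
    have := congrFun (congrFun hc (σ⁻¹ j)) (σ⁻¹ k)
    simp only [Finset.sum_apply, Pi.smul_apply, Pi.zero_apply] at this ⊢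
    rw [← this]
    refine Finset.sum_congr rfl fun i _ => ?_
    rw [← hg σ i (σ⁻¹ j) (σ⁻¹ k), show σ (σ⁻¹ j) = j from σ.apply_symm_apply j,
      show σ (σ⁻¹ k) = k from σ.apply_symm_apply k]
  have heq : ∀ i k, c i = c k := by
    intro i k
    by_contra hik
    have hne' : i ≠ k := fun h => hik (congrArg c h)
    have h1 : ∑ x, (c x - c (swap i k x)) • g x = 0 := by
      simp only [sub_smul, Finset.sum_sub_distrib, hc, zero_sub, neg_eq_zero]
      rw [← hperm (swap i k), ← Equiv.sum_comp (swap i k)]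
      simp
    rw [Fintype.sum_eq_add i k hne'] at h1
    · rw [swap_apply_left, swap_apply_right, ← neg_sub (c i), neg_smul, ← sub_eq_add_neg,
        ← smul_sub, smul_eq_zero] at h1
      rcases h1 with h1 | h1
      · exact hik (sub_eq_zero.mp h1)
      · exact hne i k hne' (sub_eq_zero.mp h1)
    · rintro x ⟨hxi, hxk⟩
      rw [swap_apply_of_ne_of_ne hxi hxk, sub_self, zero_smul]
  intro i
  have : c i • ∑ k, g k = 0 := by
    rw [Finset.smul_sum, ← hc]
    exact Finset.sum_congr rfl fun k _ => by rw [heq i k]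
  exact (smul_eq_zero.mp this).resolve_right hsum

lemma eq_top_of_perm_invariant {U : Submodule ℝ (Fin n → ℝ)}
    (hU : ∀ (σ : Perm (Fin n)), ∀ L ∈ U, L ∘ σ ∈ U) {u s : Fin n → ℝ} (hu : u ∈ U) (hs : s ∈ U)
    {i k : Fin n} (hik : u i ≠ u k) (hsum : ∑ j, s j ≠ 0) : U = ⊤ := by
  have hne : i ≠ k := fun h => hik (congrArg u h)
  have hdiff : ∀ p q : Fin n, (Pi.single p 1 - Pi.single q 1 : Fin n → ℝ) ∈ U := by
    intro p q
    by_cases hpq : p = q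
    · rw [hpq, sub_self]
      exact U.zero_mem
    obtain ⟨σ, hp, hq⟩ := exists_perm_apply_eq hne hpq
    -- `u - u ∘ swap i k` is `u i - u k` times the difference of the unit vectors at `i` and `k`;
    -- composing with `σ` moves these to `p` and `q`.
    have h1 := hU σ _ (U.smul_mem (u i - u k)⁻¹ (U.sub_mem hu (hU (swap i k) u hu)))
    convert h1 using 1
    funext x
    have hx : ∀ y, Pi.single (M := fun _ : Fin n => ℝ) y 1 x = if σ x = σ y then 1 else 0 := by
      intro y
      rw [Pi.single_apply]
      simp only [σ.injective.eq_iff]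
    simp only [Pi.sub_apply, hx, hp, hq, Function.comp_apply, Pi.smul_apply, smul_eq_mul]
    have h0 : u i - u k ≠ 0 := sub_ne_zero.mpr hik
    by_cases h2 : σ x = i
    · rw [h2, if_pos rfl, if_neg hne, swap_apply_left, sub_zero, inv_mul_cancel₀ h0]
    by_cases h3 : σ x = k
    · rw [h3, if_pos rfl, if_neg hne.symm, swap_apply_right, zero_sub, ← neg_sub (u i), mul_neg,
        inv_mul_cancel₀ h0]
    · rw [if_neg h2, if_neg h3, swap_apply_of_ne_of_ne h2 h3]
      simp
  have hsingle : ∀ p : Fin n, (Pi.single p 1 : Fin n → ℝ) ∈ U := by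
    intro p
    -- Modulo differences of unit vectors, `s` equals its coordinate sum times the unit vector at
    -- `p`.
    have h1 := U.add_mem hs (U.sum_mem (t := univ) fun q _ => U.smul_mem (s q) (hdiff p q))
    have h2 : s + ∑ q, s q • (Pi.single p 1 - Pi.single q 1 : Fin n → ℝ) =
        (∑ q, s q) • Pi.single p 1 := by
      simp only [smul_sub, Finset.sum_sub_distrib, ← Finset.sum_smul]
      have : ∑ q, s q • (Pi.single q 1 : Fin n → ℝ) = s := (pi_eq_sum_univ' s).symm
      rw [this, add_sub_cancel]
    rw [h2] at h1
    exact (U.smul_mem_iff hsum).mp h1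
  rw [eq_top_iff]
  rintro L -
  rw [pi_eq_sum_univ' L]
  exact U.sum_mem fun q _ => U.smul_mem _ (hsingle q)

end PermutedFamilies

/-! ### Slices, the contraction, and the dimension of the quadratic part -/

section Contractions

/-- The slices and the contraction of a tensor of order three. -/
def slices (T : Fin n → Fin n → Fin n → ℝ) : Option (Fin n) → Fin n → Fin n → ℝ
  | none => fun j => T j j
  | some j => T j

variable {T : Fin n → Fin n → Fin n → ℝ}

lemma isSymm₂_of_mem_span {ι : Type*} {v : ι → Fin n → Fin n → ℝ} (hv : ∀ i, IsSymm₂ (v i))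
    {Q : Fin n → Fin n → ℝ} (hQ : Q ∈ Submodule.span ℝ (Set.range v)) : IsSymm₂ Q := by
  induction hQ using Submodule.span_induction with
  | mem x hx =>
    obtain ⟨i, rfl⟩ := hx
    exact hv i
  | zero => exact fun _ _ => rfl
  | add x y _ _ hx hy => exact fun j k => congrArg₂ (· + ·) (hx j k) (hy j k)
  | smul r x _ hx => exact fun j k => congrArg (r * ·) (hx j k)

variable [NeZero ℓ]

lemma partialD_cub_zero (hT : IsSymm₃ T) (j : Fin n) :
    partialD (0 : Fin ℓ) j (cub 0 0 0 T) = (3 : ℝ) • quad 0 0 (T j) := by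
  rw [partialD_cub _ _ hT, kron_self]
  module

lemma polOp_two_cub_zero (hT : IsSymm₃ T) :
    polOp (0 : Fin ℓ) 0 2 (cub 0 0 0 T) = (6 : ℝ) • quad 0 0 (fun j => T j j) := by
  rw [polOp_two_cub _ _ hT, kron_self]
  module

omit [NeZero ℓ] in
lemma slices_isSymm₂ (a b c : ℝ) (x : Option (Fin n)) :
    IsSymm₂ (slices (cubicTensor n a b c) x) := by
  cases x with
  | none => intro j k; simp only [slices, cubicTensor]; grind
  | some j => exact (cubicTensor_isSymm₃ n a b c).isSymm₂ j

/-- The derivatives and `E_{1,1}^{(2)} f` are nonzero multiples of the quadratic forms of the slices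
and the contraction, and `quad 0 0` is injective on symmetric matrices. -/
lemma isException_iff (a b c : ℝ) : IsException (cub (0 : Fin ℓ) 0 0 (cubicTensor n a b c)) ↔
    Module.finrank ℝ (Submodule.span ℝ (Set.range (slices (cubicTensor n a b c)))) = n := by
  set T := cubicTensor n a b c with hT
  have hTs : IsSymm₃ T := cubicTensor_isSymm₃ n a b c
  set W := Submodule.span ℝ (Set.range (slices T))
  have hspan : Submodule.span ℝ (Set.range (fun j : Fin n => partialD (0 : Fin ℓ) j (cub 0 0 0 T)) ∪
      {polOp (0 : Fin ℓ) 0 2 (cub 0 0 0 T)}) = W.map (quad 0 0) := by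
    rw [Submodule.map_span]
    simp only [partialD_cub_zero hTs, polOp_two_cub_zero hTs]
    apply le_antisymm <;> rw [Submodule.span_le]
    · rintro _ (⟨j, rfl⟩ | rfl)
      · exact Submodule.smul_mem _ _ (Submodule.subset_span ⟨_, ⟨some j, rfl⟩, rfl⟩)
      · exact Submodule.smul_mem _ _ (Submodule.subset_span ⟨_, ⟨none, rfl⟩, rfl⟩)
    · rintro _ ⟨_, ⟨x, rfl⟩, rfl⟩
      cases x with
      | none =>
        exact (Submodule.smul_mem_iff _ (by norm_num : (6 : ℝ) ≠ 0)).mp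
          (Submodule.subset_span (.inr rfl))
      | some j =>
        exact (Submodule.smul_mem_iff _ (by norm_num : (3 : ℝ) ≠ 0)).mp
          (Submodule.subset_span (.inl ⟨j, rfl⟩))
  have hinj : Function.Injective ((quad (0 : Fin ℓ) 0).domRestrict W) := by
    rw [← LinearMap.ker_eq_bot, LinearMap.ker_eq_bot']
    intro Q hQ
    exact Subtype.ext
      (eq_zero_of_quad_eq_zero (isSymm₂_of_mem_span (slices_isSymm₂ a b c) Q.2) hQ)
  rw [IsException, hspan, ← LinearMap.range_domRestrict, LinearMap.finrank_range_of_inj hinj]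

lemma slices_mem_polModule (hT : IsSymm₃ T) (x : Option (Fin n)) :
    quad 0 0 (slices T x) ∈ (polModule (cub (0 : Fin ℓ) 0 0 T)).toSubmodule := by
  have hM := isClosedUnder_polModule (cub (0 : Fin ℓ) 0 0 T)
  cases x with
  | none =>
    have := hM.2 0 0 2 one_le_two _ (self_mem_polModule _)
    rw [polOp_two_cub_zero hT] at this
    exact (Submodule.smul_mem_iff _ (by norm_num)).mp this
  | some j =>
    have := hM.1 0 j _ (self_mem_polModule _)
    rw [partialD_cub_zero hT] at this
    exact (Submodule.smul_mem_iff _ (by norm_num)).mp this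

lemma row_mem_polModule (hT : IsSymm₃ T) (j k : Fin n) :
    lin 0 (T j k) ∈ (polModule (cub (0 : Fin ℓ) 0 0 T)).toSubmodule := by
  have hM := isClosedUnder_polModule (cub (0 : Fin ℓ) 0 0 T)
  have := hM.1 0 k _ (slices_mem_polModule hT (some j))
  rw [slices, partialD_quad _ _ (hT.isSymm₂ j), kron_self, one_smul, ← two_smul ℝ] at this
  exact (Submodule.smul_mem_iff _ (by norm_num)).mp this

lemma diag_mem_polModule (hT : IsSymm₃ T) :
    lin 0 (fun j => T j j j) ∈ (polModule (cub (0 : Fin ℓ) 0 0 T)).toSubmodule := by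
  have hM := isClosedUnder_polModule (cub (0 : Fin ℓ) 0 0 T)
  have := hM.2 0 0 3 (by norm_num) _ (self_mem_polModule _)
  rw [polOp_three_cub _ _ hT, kron_self] at this
  exact (Submodule.smul_mem_iff _ (by norm_num)).mp this

/-- The coefficient vectors of linear forms in the module form a permutation-invariant subspace.
Distinct slices provide a nonconstant row, and if every row and the diagonal had zero sum the tensor
would vanish. -/
lemma lin_mem_polModule (hn : 2 ≤ n) {a b c : ℝ}
    (hne : ∀ i k, i ≠ k → cubicTensor n a b c i ≠ cubicTensor n a b c k)
    (h0 : cubicTensor n a b c ≠ 0) (L : Fin n → ℝ) :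
    lin 0 L ∈ (polModule (cub (0 : Fin ℓ) 0 0 (cubicTensor n a b c))).toSubmodule := by
  have hT := cubicTensor_isSymm₃ n a b c
  set M := polModule (cub (0 : Fin ℓ) 0 0 (cubicTensor n a b c)) with hM
  have hinv : ∀ σ : Perm (Fin n), ∀ L ∈ M.toSubmodule.comap (lin (0 : Fin ℓ)),
      L ∘ σ ∈ M.toSubmodule.comap (lin 0) := by
    intro σ L hL
    have h1 := M.apply_mem_toSubmodule σ⁻¹ hL
    have h2 := diagAction_lin σ⁻¹ (0 : Fin ℓ) (L ∘ σ)
    rw [show (L ∘ σ) ∘ ⇑σ⁻¹ = L from funext fun x => by simp] at h2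
    rwa [h2] at h1
  obtain ⟨i, k, hik⟩ : ∃ i k : Fin n, i ≠ k := ⟨⟨0, by omega⟩, ⟨1, by omega⟩, by simp⟩
  obtain ⟨x, y, hxy⟩ : ∃ x y, cubicTensor n a b c i x y ≠ cubicTensor n a b c k x y := by
    by_contra! h
    exact hne i k hik (funext₂ h)
  rw [hT.1 i, hT.2 x i, hT.1 k, hT.2 x k] at hxy
  have hs : ∃ s ∈ M.toSubmodule.comap (lin 0), ∑ j, s j ≠ 0 := by
    by_contra! h
    refine h0 (cubicTensor_eq_zero hn ?_ fun j k => h _ (row_mem_polModule hT j k))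
    have := h _ (diag_mem_polModule hT)
    simp only [cubicTensor_self, Finset.sum_const, Finset.card_univ, Fintype.card_fin, nsmul_eq_mul,
      mul_eq_zero, Nat.cast_eq_zero] at this
    exact this.resolve_left (by omega)
  obtain ⟨s, hs, hsum⟩ := hs
  have := eq_top_of_perm_invariant hinv (row_mem_polModule hT x y) hs hxy hsum
  change L ∈ M.toSubmodule.comap (lin 0)
  rw [this]
  trivial

lemma isPolarizationBasis_of_span_eq (hn : 2 ≤ n) {a b c : ℝ}
    (hne : ∀ i k, i ≠ k → cubicTensor n a b c i ≠ cubicTensor n a b c k)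
    (h0 : cubicTensor n a b c ≠ 0) {ι : Type*} {v : ι → Fin n → Fin n → ℝ}
    {act : Perm (Fin n) → ι → ι} (hv : LinearIndependent ℝ v)
    (hspan : Submodule.span ℝ (Set.range v) =
      Submodule.span ℝ (Set.range (slices (cubicTensor n a b c))))
    (hact : ∀ (σ : Perm (Fin n)) i j k, v (act σ i) (σ j) (σ k) = v i j k) :
    IsPolarizationBasis ℓ (cubicTensor n a b c) (fun j : Fin n => Pi.single j 1) v
      (fun σ j => σ j) act := by
  have hT := cubicTensor_isSymm₃ n a b c
  have hv' : ∀ i, v i ∈ Submodule.span ℝ (Set.range (slices (cubicTensor n a b c))) := fun i =>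
    hspan ▸ Submodule.subset_span ⟨i, rfl⟩
  have htop : ∀ L : Fin n → ℝ,
      L ∈ Submodule.span ℝ (Set.range fun j : Fin n => (Pi.single j 1 : Fin n → ℝ)) := by
    intro L
    rw [pi_eq_sum_univ' L]
    exact Submodule.sum_mem _ fun j _ => Submodule.smul_mem _ _ (Submodule.subset_span ⟨j, rfl⟩)
  refine
    { symm₃ := hT
      symm₂ := fun i => isSymm₂_of_mem_span (slices_isSymm₂ a b c) (hv' i)
      perm₃ := cubicTensor_perm n a b c
      perm₂ := hact
      perm₁ := fun σ i j => by simp only [Pi.single_apply, σ.injective.eq_iff]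
      linearIndependent₂ := hv
      linearIndependent₁ := Pi.linearIndependent_single_one _ _
      slice := fun j => hspan ▸ Submodule.subset_span ⟨some j, rfl⟩
      contract := hspan ▸ Submodule.subset_span ⟨none, rfl⟩
      row := fun _ _ => htop _
      diag := fun _ => htop _
      quad_mem := fun i => ?_
      lin_mem := fun j => lin_mem_polModule hn hne h0 _ }
  have hle : Submodule.span ℝ (Set.range (slices (cubicTensor n a b c))) ≤
      (polModule (cub (0 : Fin ℓ) 0 0 (cubicTensor n a b c))).toSubmodule.comap (quad 0 0) := by
    rw [Submodule.span_le]
    rintro _ ⟨x, rfl⟩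
    exact slices_mem_polModule hT x
  exact hle (hv' i)

omit [NeZero ℓ] in
-- The family is `T i + t • contraction`, with `t = 0` unless the slices sum to zero, and then `t =
-- 1`. In the latter case the sum is `n` times the contraction; if that vanished too, then `a = 0`,
-- all row sums would be zero and so would `T`.
lemma exists_permuted_basis (hn : 2 ≤ n) {a b c : ℝ}
    (hne : ∀ i k, i ≠ k → cubicTensor n a b c i ≠ cubicTensor n a b c k)
    (h0 : cubicTensor n a b c ≠ 0) :
    ∃ g : Fin n → Fin n → Fin n → ℝ, LinearIndependent ℝ g ∧
      (∀ i, g i ∈ Submodule.span ℝ (Set.range (slices (cubicTensor n a b c)))) ∧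
      ∀ (σ : Perm (Fin n)) i j k, g (σ i) (σ j) (σ k) = g i j k := by
  have hT := cubicTensor_isSymm₃ n a b c
  set T := cubicTensor n a b c with hTdef
  have key : ∀ t : ℝ, ∑ i, (T i + t • slices T none) ≠ 0 →
      ∃ g : Fin n → Fin n → Fin n → ℝ, LinearIndependent ℝ g ∧
      (∀ i, g i ∈ Submodule.span ℝ (Set.range (slices T))) ∧
      ∀ (σ : Perm (Fin n)) i j k, g (σ i) (σ j) (σ k) = g i j k := by
    intro t ht
    have hperm : ∀ (σ : Perm (Fin n)) i j k, (T (σ i) + t • slices T none) (σ j) (σ k) =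
        (T i + t • slices T none) j k := by
      intro σ i j k
      simp only [slices, Pi.add_apply, Pi.smul_apply, hTdef, cubicTensor_perm]
    refine ⟨fun i => T i + t • slices T none,
      linearIndependent_of_perm hperm (fun i k hik h => hne i k hik (add_right_cancel h)) ht,
      fun i => ?_, hperm⟩
    exact Submodule.add_mem _ (Submodule.subset_span ⟨some i, rfl⟩)
      (Submodule.smul_mem _ _ (Submodule.subset_span ⟨none, rfl⟩))
  by_cases hsum : ∑ i, T i = 0
  · refine key 1 fun h => h0 ?_
    rw [Finset.sum_add_distrib, hsum, zero_add, Finset.sum_const, Finset.card_univ,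
      Fintype.card_fin, one_smul, smul_eq_zero] at h
    have hG : slices T none = 0 := h.resolve_left (by omega)
    refine cubicTensor_eq_zero hn ?_ fun j k => ?_
    · have := congrFun (congrFun hG ⟨0, by omega⟩) ⟨0, by omega⟩
      exact (cubicTensor_self n a b c _).symm.trans this
    · have := congrFun (congrFun hsum j) k
      rw [Finset.sum_apply, Finset.sum_apply] at this
      refine Eq.trans ?_ this
      exact Finset.sum_congr rfl fun m _ => by rw [hT.1 m, hT.2 j]
  · refine key 0 ?_
    simpa using hsum

end Contractions

/-! ### Jacobi–Trudi for one row and for `(n-1, 1)` -/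

section SchurFunctions

lemma hSymPart_singleton (ι R : Type*) [CommRing R] (k : ℕ) : hSymPart ι R [k] = hSym ι R k := by
  simp [hSymPart]

lemma schur_singleton (ι R : Type*) [CommRing R] (k : ℕ) : schur ι R [k] = hSym ι R k := by
  change Matrix.det (n := Fin 1) _ = _
  rw [Matrix.det_fin_one]
  simp

/-- The `2 × 2` determinant is `h_{n-1} h_1 - h_n h_0`. -/
lemma schur_hook {n : ℕ} (hn : 1 ≤ n) (ι R : Type*) [CommRing R] :
    schur ι R [n - 1, 1] = hSymPart ι R [n - 1, 1] - hSym ι R n := by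
  change Matrix.det (n := Fin 2) _ = _
  rw [Matrix.det_fin_two]
  simp [hSymPart, hSym_zero, Nat.sub_add_cancel hn]

lemma hw_hook (ℓ : ℕ) (hn : 1 ≤ n) : hw ℓ [n - 1, 1] = sw ℓ [n - 1, 1] + sw ℓ [n] := by
  rw [hw, sw, sw, schur_hook hn, schur_singleton, ← map_add, sub_add_cancel]

lemma hw_singleton (ℓ k : ℕ) : hw ℓ [k] = sw ℓ [k] := by
  rw [hw, sw, schur_singleton, hSymPart_singleton]

lemma hq_eq_sq (ℓ k : ℕ) : hq ℓ k = sq ℓ k := (schur_singleton _ _ _).symm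

end SchurFunctions

/-! ### The three cases -/

section FrobeniusCharacteristics

variable [NeZero ℓ]

/-- Here the tensor is constant, and every form in the module is a combination of products of the
row sums, which permutations fix. -/
theorem frobChar_cubic_power {k : ℝ} (hk : k ≠ 0) (hn : 2 ≤ n) :
    frobChar (polModule (k • cubic ℓ n 1 3 6)) =
      (1 + hq ℓ 1 + hq ℓ 2 + hq ℓ 3) * hw ℓ [n] := by
  let j₀ : Fin n := ⟨0, by omega⟩
  have hf : k • cubic ℓ n 1 3 6 = cub 0 0 0 fun _ _ _ => k := by
    rw [cubic_eq_cub, cubicTensor_one_three_six, ← map_smul]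
    congr 1
    funext _ _ _
    exact mul_one k
  have hT : IsSymm₃ fun _ _ _ : Fin n => k := ⟨fun _ _ _ => rfl, fun _ _ _ => rfl⟩
  have h1 : (fun _ : Fin n => k) = k • fun _ => 1 := funext fun _ => (mul_one k).symm
  have h2 : (fun _ _ : Fin n => k) = k • fun _ _ => 1 := funext₂ fun _ _ => (mul_one k).symm
  have hbasis : IsPolarizationBasis ℓ (fun _ _ _ : Fin n => k) (fun _ : Unit => fun _ => 1)
      (fun _ : Unit => fun _ _ => 1) (fun _ i => i) (fun _ i => i) :=
    { symm₃ := hT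
      symm₂ := fun _ _ _ => rfl
      perm₃ := fun _ _ _ _ => rfl
      perm₂ := fun _ _ _ _ => rfl
      perm₁ := fun _ _ _ => rfl
      linearIndependent₂ := LinearIndependent.of_subsingleton () fun h =>
        one_ne_zero (congrFun (congrFun h j₀) j₀)
      linearIndependent₁ := LinearIndependent.of_subsingleton () fun h =>
        one_ne_zero (congrFun h j₀)
      slice := fun _ => h2 ▸ Submodule.smul_mem _ _ (Submodule.subset_span ⟨(), rfl⟩)
      contract := h2 ▸ Submodule.smul_mem _ _ (Submodule.subset_span ⟨(), rfl⟩)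
      row := fun _ _ => Submodule.subset_span ⟨(), rfl⟩
      diag := fun _ => Submodule.subset_span ⟨(), rfl⟩
      quad_mem := fun _ => by
        have := slices_mem_polModule (ℓ := ℓ) hT (some j₀)
        have he : slices (fun _ _ _ : Fin n => k) (some j₀) = k • fun _ _ => 1 := h2
        rw [he, map_smul] at this
        exact (Submodule.smul_mem_iff _ hk).mp this
      lin_mem := fun _ => by
        have := row_mem_polModule (ℓ := ℓ) hT j₀ j₀
        refine (Submodule.smul_mem_iff _ hk).mp ?_
        rw [← map_smul, ← h1]
        exact this }
  have h0 : cub (0 : Fin ℓ) 0 0 (fun _ _ _ : Fin n => k) ≠ 0 := by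
    intro h
    have h3 := partialD_cub_zero (ℓ := ℓ) hT j₀
    rw [h, map_zero, eq_comm, smul_eq_zero_iff_right (by norm_num)] at h3
    have h4 := eq_zero_of_quad_eq_zero (fun _ _ => rfl) h3
    exact hk (congrFun (congrFun h4 j₀) j₀)
  rw [hf, hbasis.frobChar_eq h0, permFrob_unit]
  ring

variable {a b c : ℝ}

theorem frobChar_cubic_of_isException (hn : 2 ≤ n) (h0 : cubic ℓ n a b c ≠ 0)
    (h : IsException (cubic ℓ n a b c)) :
    frobChar (polModule (cubic ℓ n a b c)) =
      (1 + hq ℓ 3) * hw ℓ [n] + (hq ℓ 1 + hq ℓ 2) * hw ℓ [n - 1, 1] := by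
  rw [cubic_eq_cub] at h h0 ⊢
  rw [isException_iff] at h
  have hT0 : cubicTensor n a b c ≠ 0 := fun h => h0 (by rw [h, map_zero])
  have hne : ∀ i k, i ≠ k → cubicTensor n a b c i ≠ cubicTensor n a b c k := by
    intro i k hik heq
    have hconst := cubicTensor_eq_const hik heq
    -- A constant tensor would make this span at most one-dimensional, contradicting dimension `n ≥
    -- 2`; hence an exception is never a multiple of `p_1^3`.
    have hle : Submodule.span ℝ (Set.range (slices (cubicTensor n a b c))) ≤
        Submodule.span ℝ {fun _ _ => 1} := by
      rw [Submodule.span_le]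
      rintro _ ⟨x, rfl⟩
      refine Submodule.mem_span_singleton.mpr ⟨a, ?_⟩
      rw [hconst]
      cases x <;> exact funext₂ fun _ _ => mul_one a
    have := (Submodule.finrank_mono hle).trans (finrank_span_le_card _)
    simp at this
    omega
  obtain ⟨g, hg, hmem, hperm⟩ := exists_permuted_basis hn hne hT0
  have hspan : Submodule.span ℝ (Set.range g) =
      Submodule.span ℝ (Set.range (slices (cubicTensor n a b c))) := by
    refine Submodule.eq_of_le_of_finrank_eq (Submodule.span_le.mpr ?_) ?_
    · rintro _ ⟨i, rfl⟩
      exact hmem i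
    · rw [h, finrank_span_eq_card hg, Fintype.card_fin]
  rw [(isPolarizationBasis_of_span_eq (act := fun σ i => σ i) hn hne hT0 hg hspan
    hperm).frobChar_eq h0, permFrob_fin (by omega)]
  ring

theorem frobChar_cubic_of_not_isException (hn : 2 ≤ n) (h0 : cubic ℓ n a b c ≠ 0)
    (h1 : ¬ ∃ k : ℝ, cubic ℓ n a b c = k • cubic ℓ n 1 3 6)
    (h : ¬ IsException (cubic ℓ n a b c)) :
    frobChar (polModule (cubic ℓ n a b c)) =
      (1 + hq ℓ 2 + hq ℓ 3) * hw ℓ [n] + (hq ℓ 1 + hq ℓ 2) * hw ℓ [n - 1, 1] := by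
  rw [cubic_eq_cub] at h h0 h1 ⊢
  rw [isException_iff] at h
  have hT0 : cubicTensor n a b c ≠ 0 := fun h => h0 (by rw [h, map_zero])
  have hne : ∀ i k, i ≠ k → cubicTensor n a b c i ≠ cubicTensor n a b c k := by
    intro i k hik heq
    refine h1 ⟨a, ?_⟩
    rw [cubic_eq_cub, cubicTensor_one_three_six, cubicTensor_eq_const hik heq, ← map_smul]
    congr 1
    funext _ _ _
    exact (mul_one a).symm
  obtain ⟨g, hg, hmem, -⟩ := exists_permuted_basis hn hne hT0
  have hle : Submodule.span ℝ (Set.range g) ≤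
      Submodule.span ℝ (Set.range (slices (cubicTensor n a b c))) := by
    rw [Submodule.span_le]
    rintro _ ⟨i, rfl⟩
    exact hmem i
  have hlow := Submodule.finrank_mono hle
  rw [finrank_span_eq_card hg, Fintype.card_fin] at hlow
  have hup := finrank_range_le_card (R := ℝ) (slices (cubicTensor n a b c))
  rw [Fintype.card_option, Fintype.card_fin, Set.finrank] at hup
  -- The dimension lies between `n` and `n + 1` and is not `n`, so the slices and the contraction
  -- together are a permuted basis.
  have hindep : LinearIndependent ℝ (slices (cubicTensor n a b c)) := by
    rw [linearIndependent_iff_card_eq_finrank_span, Fintype.card_option, Fintype.card_fin,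
      Set.finrank]
    omega
  have hperm : ∀ (σ : Perm (Fin n)) (x : Option (Fin n)) j k,
      slices (cubicTensor n a b c) (x.map σ) (σ j) (σ k) = slices (cubicTensor n a b c) x j k := by
    intro σ x j k
    cases x <;> exact cubicTensor_perm n a b c σ _ _ _
  rw [(isPolarizationBasis_of_span_eq (act := fun σ x => x.map σ) hn hne hT0 hindep rfl
    hperm).frobChar_eq h0, permFrob_fin (by omega), permFrob_option (by omega), map_add]
  ring

end FrobeniusCharacteristics

end Polarization
end

theorem mainTheorem3 (ℓ n : ℕ) [NeZero ℓ] (hn : 2 ≤ n) (a b c : ℝ)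
    (f : Polarization.MatPoly ℓ n) (hf : f = Polarization.cubic ℓ n a b c) (hf0 : f ≠ 0) :
    ((∃ k : ℝ, f = k • Polarization.cubic ℓ n 1 3 6) →
      Polarization.frobChar (Polarization.polModule f) =
        (1 + Polarization.hq ℓ 1 + Polarization.hq ℓ 2 + Polarization.hq ℓ 3) *
          Polarization.hw ℓ [n]) ∧
    (Polarization.IsException f →
      Polarization.frobChar (Polarization.polModule f) =
        (1 + Polarization.hq ℓ 3) * Polarization.hw ℓ [n] +
          (Polarization.hq ℓ 1 + Polarization.hq ℓ 2) * Polarization.hw ℓ [n - 1, 1] ∧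
      Polarization.frobChar (Polarization.polModule f) =
        (1 + Polarization.sq ℓ 1 + Polarization.sq ℓ 2 + Polarization.sq ℓ 3) *
            Polarization.sw ℓ [n] +
          (Polarization.sq ℓ 1 + Polarization.sq ℓ 2) * Polarization.sw ℓ [n - 1, 1]) ∧
    ((¬ ∃ k : ℝ, f = k • Polarization.cubic ℓ n 1 3 6) → ¬ Polarization.IsException f →
      Polarization.frobChar (Polarization.polModule f) =
        (1 + Polarization.hq ℓ 2 + Polarization.hq ℓ 3) * Polarization.hw ℓ [n] +
          (Polarization.hq ℓ 1 + Polarization.hq ℓ 2) * Polarization.hw ℓ [n - 1, 1] ∧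
      Polarization.frobChar (Polarization.polModule f) =
        (1 + Polarization.sq ℓ 1 + 2 * Polarization.sq ℓ 2 + Polarization.sq ℓ 3) *
            Polarization.sw ℓ [n] +
          (Polarization.sq ℓ 1 + Polarization.sq ℓ 2) * Polarization.sw ℓ [n - 1, 1]) := by
  open Polarization in
  have hn1 : 1 ≤ n := by omega
  refine ⟨?_, fun hex => ?_, fun hpow hex => ?_⟩
  · rintro ⟨k, rfl⟩
    exact frobChar_cubic_power (fun hk => hf0 (by rw [hk, zero_smul])) hn
  · subst hf
    -- The Schur form is derived from the first form by splitting `h_{n-1,1}`, whose summand `s_n`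
    -- joins the coefficient of `h_n = s_n`.
    refine and_iff_left_of_imp (fun h => ?_) |>.mpr (frobChar_cubic_of_isException hn hf0 hex)
    rw [h, hw_hook ℓ hn1, hw_singleton, hq_eq_sq, hq_eq_sq, hq_eq_sq]
    ring
  · subst hf
    refine and_iff_left_of_imp (fun h => ?_) |>.mpr
      (frobChar_cubic_of_not_isException hn hf0 hpow hex)
    rw [h, hw_hook ℓ hn1, hw_singleton, hq_eq_sq, hq_eq_sq, hq_eq_sq]
    ring
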